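/- Let $X, X_1, X_2, \dots$ be independent, identically distributed real random variables with $\mathbb{E}X=0$ and $\mathrm{Var}(X)=1$, and let $Z_n=(X_1+\dots+X_n)/\sqrt n$. Let $\varphi(x)=\frac1{\sqrt{2\pi}}e^{-x^2/2}$ be the standard normal density. For a probability density $p$ on $\mathbb{R}$ and $\alpha>0$, $\alpha\neq 1$, let $$D_\alpha(p\|\varphi)=\frac{1}{\alpha-1}\log\int_{-\infty}^{\infty}\Big(\frac{p(x)}{\varphi(x)}\Big)^{\alpha}\varphi(x)\,dx\in[0,\infty],$$ and let $D_1(p\|\varphi)=\int_{-\infty}^{\infty} p\log\frac{p}{\varphi}\,dx\in[0,\infty]$ be the relative entropy. Write $p_n$ for the density of $Z_n$, and put $D_\alpha(p_n\|\varphi)=\infty$ if $Z_n$ has no density. **Theorem 1.1.** Assume that for every $\alpha>1$ there is $n=n_\alpha\ge 1$ such that $D_\alpha(p_n\|\varphi)<\infty$. Then $D_\alpha(p_n\|\varphi)\to0$ as $n\to\infty$ for all $\alpha>1$ if and only if $\mathbb{E}\,e^{tX}\le e^{t^2/2}$ for all $t\in\mathbb{R}$ (that is, $X$ is strictly subgaussian).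 The same equivalence holds with "for all $\alpha>1$" replaced by "for all $\alpha>0$". -/

import Mathlib

open MeasureTheory ProbabilityTheory Filter
open scoped ENNReal Topology

noncomputable section

/-- Rényi divergence `D_α(p‖φ)` of order `α` of a probability density `p` on the line from the
standard normal density `φ`:
`(α - 1)⁻¹ log ∫ (p / φ)^α φ dx` for `α ≠ 1` (with `log 0 = -∞`, `log ∞ = ∞`), and the relative
entropy `∫ p log (p / φ) dx ∈ [0, ∞]` for `α = 1`. -/
def renyiDivDensity (α : ℝ) (p : ℝ → ℝ≥0∞) : EReal :=
  if α = 1 then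
    (InformationTheory.klDiv (volume.withDensity p) (gaussianReal 0 1) : EReal)
  else
    (((α - 1)⁻¹ : ℝ) : EReal) *
      ENNReal.log (∫⁻ x, (p x / gaussianPDF 0 1 x) ^ α * gaussianPDF 0 1 x)

open Classical in
/-- Rényi divergence from the standard normal law of a probability law `μ` on the line, computed
from its Lebesgue density; it is `∞` when `μ` has no density. -/
def renyiDiv (α : ℝ) (μ : Measure ℝ) : EReal :=
  if μ ≪ volume then renyiDivDensity α (μ.rnDeriv volume) else ⊤

/-- The normalized sum `Z_n = (X_1 + ⋯ + X_n) / √n` (the sequence is indexed from `0`). -/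
def normalizedSum {Ω : Type*} (X : ℕ → Ω → ℝ) (n : ℕ) (ω : Ω) : ℝ :=
  (∑ i ∈ Finset.range n, X i ω) / √(n : ℝ)

end

/-!
# Convergence of Rényi divergences in the central limit theorem

Let `G z = E exp (z X)` and let `pₙ` be the density of the normalized sum `Zₙ`.

*Necessity.* Hölder's inequality bounds `E exp (t Zₙ) = G (t / √n) ^ n` by a constant times
`exp (β t² / 2)`, where `β` is the exponent conjugate to `α` and the constant is controlled by the
divergence of order `α`. Replacing `t` by `√n t`, taking `n`-th roots, and letting `n → ∞` and then
`α → ∞` (so that `β → 1`) gives `E exp (t X) ≤ exp (t² / 2)`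
(`lintegral_exp_le_of_tendsto_renyiDiv`).

*Sufficiency.* The point is the bound `pₙ(x) / φ(x) ≤ C exp (c x² / n)` with `C` and `c` independent
of `n`. Every power of its right side is integrable against `φ` for large `n`, uniformly in `n`, so
that dominated convergence reduces all orders `α > 0`, relative entropy included, to the pointwise
convergence `pₙ → φ` (`tendsto_renyiDiv`).

To prove the bound, consider the exponentially tilted measure `exp (h x) pₙ(x) dx`. Its
characteristic function at `s` is `G ((h + i s) / √n) ^ n`, so Fourier inversion bounds its density
by the `L¹` norm of this function of `s`. Strict subgaussianity gives
`G (h / √n) ^ n ≤ exp (h² / 2)`, and what remains is to show that the integral over `u` of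
`(|G (t + i u)| / G t) ^ n` is at most `C exp (c t²) / √n`; the choice `h = x` then gives the claim
(`exists_expTilt_le`, `ae_rnDeriv_le_of_expTilt_le`). Only the finiteness of the divergence of order
`2` for one number `m` of summands is needed for this. First, it puts `exp (h x) pₘ(x)` into `L²`
for every `h`, with norm of Gaussian growth in `h`, and Plancherel's inequality
(`lintegral_charFun_sq_le`) makes `|G (t + i u)| ^ (2 m)` integrable in `u`. Second, it makes the
law of `Zₘ` absolutely continuous, so that `1 - (|G (t + i u)| / G t) ^ (2 m)` is at least
`b exp (-c t²) min (1, u²)`: for a single measure this follows from the Riemann–Lebesgue lemma and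
the doubling inequality `1 - cos 2θ ≤ 4 (1 - cos θ)` (`exists_defect_ge`), and since the defect
`σ(ℝ)² - |charFun σ|²` is an integral over pairs of points, it is monotone in the measure and all
tilts can be compared with one measure of compact support (`exists_complexMGF_defect_ge`).

The same estimates at `t = 0` upgrade the pointwise convergence of characteristic functions to
convergence in `L¹` (`tendsto_lintegral_charFun_sub`), hence to uniform convergence of densities
(`ae_tendsto_rnDeriv`). Both this step and the density bounds rest on one comparison principle,
proved by smoothing with Gaussian kernels: if the characteristic functions of `σ` and `τ` differ by
at most `2πc` in `L¹`, then `σ ≤ τ + c • volume` (`measure_le_add_smul_volume`).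
-/

open scoped NNReal

namespace SubgaussianCLT

/-! ### Smoothing by Gaussian kernels -/

lemma gaussianPDFReal_eq_fourier {v : ℝ≥0} (hv : v ≠ 0) (u : ℝ) :
    (gaussianPDFReal 0 v u : ℂ) = ((2 * Real.pi)⁻¹ : ℝ) *
      ∫ s : ℝ, Complex.exp (-(u * s * Complex.I)) * Complex.exp (-(v / 2 : ℝ) * s ^ 2) := by
  have hv' : (0 : ℝ) < v := by positivity
  have h := fourierIntegral_gaussian (b := ((v / 2 : ℝ) : ℂ))
    (by rw [Complex.ofReal_re]; positivity) (-u : ℂ)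
  have h1 : ∀ s : ℝ, Complex.exp (Complex.I * (-u : ℂ) * s) = Complex.exp (-(u * s * Complex.I)) :=
    fun s ↦ by congr 1; ring
  simp_rw [h1] at h
  have h2 : ((Real.pi : ℂ) / ((v / 2 : ℝ) : ℂ)) ^ (1 / 2 : ℂ) = ((√(2 * Real.pi / v) : ℝ) : ℂ) := by
    rw [Real.sqrt_eq_rpow, Complex.ofReal_cpow (by positivity)]
    push_cast
    congr 1
    field_simp
  have h3 : Complex.exp (-(-u : ℂ) ^ 2 / (4 * ((v / 2 : ℝ) : ℂ))) =
      ((Real.exp (-u ^ 2 / (2 * v)) : ℝ) : ℂ) := by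
    push_cast
    congr 1
    field_simp
    ring
  rw [h, h2, h3, gaussianPDFReal, ← Complex.ofReal_mul, ← Complex.ofReal_mul, Complex.ofReal_inj,
    ← mul_assoc]
  congr 1
  · rw [Real.sqrt_div (by positivity), Real.sqrt_mul (by positivity) (v : ℝ)]
    have : √(2 * Real.pi) ^ 2 = 2 * Real.pi := Real.sq_sqrt (by positivity)
    have h4 : (2 * Real.pi)⁻¹ = (√(2 * Real.pi) ^ 2)⁻¹ := by rw [this]
    rw [h4]
    field_simp
  · simp

/-- Smoothing a finite measure by a Gaussian kernel multiplies its characteristic function by a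
Gaussian, which makes Fourier inversion an instance of Fubini's theorem. -/
lemma integral_gaussianPDFReal_sub {v : ℝ≥0} (hv : v ≠ 0) (σ : Measure ℝ) [IsFiniteMeasure σ]
    (x : ℝ) :
    ((∫ y, gaussianPDFReal 0 v (x - y) ∂σ : ℝ) : ℂ) = ((2 * Real.pi)⁻¹ : ℝ) *
      ∫ s : ℝ, charFun σ s *
        (Complex.exp (-(x * s * Complex.I)) * Complex.exp (-(v / 2 : ℝ) * s ^ 2)) := by
  have hv' : (0 : ℝ) < v := by positivity
  have hgauss : Integrable (fun s : ℝ ↦ Real.exp (-(v / 2 : ℝ) * s ^ 2)) :=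
    integrable_exp_neg_mul_sq (by positivity)
  rw [← integral_complex_ofReal]
  simp_rw [gaussianPDFReal_eq_fourier hv]
  rw [integral_const_mul, integral_integral_swap]
  · congr 1
    refine integral_congr_ae (ae_of_all _ fun s ↦ ?_)
    simp only
    rw [charFun_apply_real, ← integral_mul_const]
    refine integral_congr_ae (ae_of_all _ fun y ↦ ?_)
    simp only
    have : Complex.exp (-(((x - y : ℝ) : ℂ) * s * Complex.I)) =
        Complex.exp (s * y * Complex.I) * Complex.exp (-(x * s * Complex.I)) := by
      rw [← Complex.exp_add]
      push_cast
      ring_nf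
    rw [this, mul_assoc]
  · have : Integrable (fun p : ℝ × ℝ ↦ (1 : ℝ) * Real.exp (-(v / 2 : ℝ) * p.2 ^ 2))
        (σ.prod volume) := (integrable_const (1 : ℝ)).mul_prod hgauss
    refine this.mono' (Measurable.aestronglyMeasurable (by fun_prop)) (ae_of_all _ fun p ↦ ?_)
    simp only [Function.uncurry]
    rw [norm_mul, one_mul]
    have e1 : ‖Complex.exp (-(((x - p.1 : ℝ) : ℂ) * p.2 * Complex.I))‖ = 1 := by
      rw [Complex.norm_exp]; simp
    have e2 : ‖Complex.exp (-((v / 2 : ℝ) : ℂ) * (p.2 : ℂ) ^ 2)‖ =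
        Real.exp (-(v / 2 : ℝ) * p.2 ^ 2) := by
      rw [Complex.norm_exp]; norm_cast
    rw [e1, e2, one_mul]

lemma integrable_charFun_mul_exp {v : ℝ≥0} (hv : v ≠ 0) (σ : Measure ℝ) [IsFiniteMeasure σ]
    (x : ℝ) :
    Integrable fun s : ℝ ↦ charFun σ s *
        (Complex.exp (-(x * s * Complex.I)) * Complex.exp (-(v / 2 : ℝ) * s ^ 2)) := by
  have hv' : (0 : ℝ) < v := by positivity
  have hgauss : Integrable (fun s : ℝ ↦ Real.exp (-(v / 2 : ℝ) * s ^ 2)) :=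
    integrable_exp_neg_mul_sq (by positivity)
  refine (hgauss.const_mul (σ.real Set.univ)).mono'
    (Measurable.aestronglyMeasurable (by fun_prop)) (ae_of_all _ fun s ↦ ?_)
  rw [norm_mul, norm_mul]
  have e1 : ‖Complex.exp (-((x : ℂ) * s * Complex.I))‖ = 1 := by
    rw [Complex.norm_exp]; simp
  have e2 : ‖Complex.exp (-((v / 2 : ℝ) : ℂ) * (s : ℂ) ^ 2)‖ = Real.exp (-(v / 2 : ℝ) * s ^ 2) := by
    rw [Complex.norm_exp]; norm_cast
  rw [e1, e2, one_mul]
  gcongr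
  exact norm_charFun_le s

lemma integrable_gaussianPDFReal_sub {v : ℝ≥0} (σ : Measure ℝ) [IsFiniteMeasure σ]
    (x : ℝ) : Integrable (fun y ↦ gaussianPDFReal 0 v (x - y)) σ := by
  refine Integrable.of_bound (C := (√(2 * Real.pi * v))⁻¹)
    (Measurable.aestronglyMeasurable (by fun_prop)) (ae_of_all _ fun y ↦ ?_)
  rw [Real.norm_of_nonneg (gaussianPDFReal_nonneg ..), gaussianPDFReal]
  refine mul_le_of_le_one_right (by positivity) (Real.exp_le_one_iff.2 ?_)
  rw [neg_div, neg_nonpos]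
  positivity

lemma lintegral_gaussianPDF_sub {v : ℝ≥0} (σ : Measure ℝ) [IsFiniteMeasure σ]
    (x : ℝ) : ∫⁻ y, gaussianPDF 0 v (x - y) ∂σ =
      ENNReal.ofReal (∫ y, gaussianPDFReal 0 v (x - y) ∂σ) :=
  (ofReal_integral_eq_lintegral_ofReal (integrable_gaussianPDFReal_sub σ x)
    (ae_of_all _ fun _ ↦ gaussianPDFReal_nonneg ..)).symm

/-- If the characteristic functions of two finite measures are close in `L¹`, then the measures
are comparable after smoothing, with an error independent of the kernel. -/
lemma lintegral_gaussianPDF_sub_le {v : ℝ≥0} (hv : v ≠ 0) (σ τ : Measure ℝ) [IsFiniteMeasure σ]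
    [IsFiniteMeasure τ] {c : ℝ≥0∞}
    (h : ∫⁻ s, ‖charFun σ s - charFun τ s‖ₑ ≤ ENNReal.ofReal (2 * Real.pi) * c) (x : ℝ) :
    ∫⁻ y, gaussianPDF 0 v (x - y) ∂σ ≤ ∫⁻ y, gaussianPDF 0 v (x - y) ∂τ + c := by
  rcases eq_or_ne c ⊤ with rfl | hc
  · simp
  rw [lintegral_gaussianPDF_sub, lintegral_gaussianPDF_sub, ← ENNReal.ofReal_toReal hc,
    ← ENNReal.ofReal_add (integral_nonneg fun _ ↦ gaussianPDFReal_nonneg ..)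
      ENNReal.toReal_nonneg]
  refine ENNReal.ofReal_le_ofReal ?_
  rw [← sub_le_iff_le_add']
  have hD : ENNReal.ofReal (2 * Real.pi) * c ≠ ⊤ := ENNReal.mul_ne_top ENNReal.ofReal_ne_top hc
  have hint : Integrable (fun s ↦ charFun σ s - charFun τ s) :=
    ⟨Measurable.aestronglyMeasurable (by fun_prop), lt_of_le_of_lt h hD.lt_top⟩
  have hD' : ∫ s, ‖charFun σ s - charFun τ s‖ ≤ 2 * Real.pi * c.toReal := by
    rw [integral_norm_eq_lintegral_enorm hint.1]
    refine (ENNReal.toReal_mono hD h).trans ?_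
    rw [ENNReal.toReal_mul, ENNReal.toReal_ofReal (by positivity)]
  refine (le_abs_self _).trans ?_
  rw [← Real.norm_eq_abs, ← Complex.norm_real, Complex.ofReal_sub,
    integral_gaussianPDFReal_sub hv, integral_gaussianPDFReal_sub hv, ← mul_sub,
    ← integral_sub (integrable_charFun_mul_exp hv σ x) (integrable_charFun_mul_exp hv τ x),
    norm_mul, Complex.norm_real, Real.norm_of_nonneg (by positivity)]
  rw [inv_mul_le_iff₀ (by positivity)]
  refine le_trans ?_ hD'
  refine norm_integral_le_of_norm_le hint.norm (ae_of_all _ fun s ↦ ?_)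
  rw [← sub_mul, norm_mul, norm_mul]
  have e1 : ‖Complex.exp (-((x : ℂ) * s * Complex.I))‖ = 1 := by
    rw [Complex.norm_exp]; simp
  have e2 : ‖Complex.exp (-((v / 2 : ℝ) : ℂ) * (s : ℂ) ^ 2)‖ = Real.exp (-(v / 2 : ℝ) * s ^ 2) := by
    rw [Complex.norm_exp]; norm_cast
  rw [e1, e2, one_mul]
  refine mul_le_of_le_one_right (norm_nonneg _) (Real.exp_le_one_iff.2 ?_)
  rw [neg_mul, neg_nonpos]
  positivity

/-- Domination for integrals of bounded continuous functions gives domination of measures. -/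
lemma measure_le_of_forall_lintegral_le {σ ρ : Measure ℝ} [IsFiniteMeasure σ] [ρ.OuterRegular]
    (h : ∀ f : ℝ → ℝ≥0, Continuous f → (∀ x, f x ≤ 1) → ∫⁻ x, f x ∂σ ≤ ∫⁻ x, f x ∂ρ) :
    σ ≤ ρ := by
  refine Measure.le_iff.2 fun A hA ↦ ?_
  rw [hA.measure_eq_iSup_isCompact_of_ne_top (measure_ne_top σ A), Set.measure_eq_iInf_isOpen A ρ]
  refine iSup₂_le fun K hKA ↦ iSup_le fun hK ↦ le_iInf₂ fun U hAU ↦ le_iInf fun hU ↦ ?_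
  obtain ⟨f, hf0, hf1, -, hf⟩ := exists_continuous_one_zero_of_isCompact hK hU.isClosed_compl
    (Set.disjoint_compl_right_iff_subset.2 (hKA.trans hAU))
  have hK1 : ∀ x ∈ K, f x = 1 := fun x hx ↦ hf0 hx
  have hU0 : ∀ x ∉ U, f x = 0 := fun x hx ↦ hf1 hx
  calc σ K = ∫⁻ x, K.indicator 1 x ∂σ := (lintegral_indicator_one hK.measurableSet).symm
    _ ≤ ∫⁻ x, (f x).toNNReal ∂σ := by
        refine lintegral_mono fun x ↦ ?_
        by_cases hx : x ∈ K <;> simp [hx, hK1]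
    _ ≤ ∫⁻ x, (f x).toNNReal ∂ρ := by
        refine h _ (by fun_prop) fun x ↦ ?_
        simpa using (hf x).2
    _ ≤ ∫⁻ x, U.indicator 1 x ∂ρ := by
        refine lintegral_mono fun x ↦ ?_
        by_cases hx : x ∈ U
        · simpa [hx] using (hf x).2
        · simp [hx, hU0]
    _ = ρ U := lintegral_indicator_one hU.measurableSet

lemma lintegral_lintegral_gaussianPDF_sub {v : ℝ≥0} (hv : v ≠ 0) (σ : Measure ℝ)
    [IsFiniteMeasure σ] {f : ℝ → ℝ≥0} (hf : Continuous f) :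
    ∫⁻ x, f x * ∫⁻ y, gaussianPDF 0 v (x - y) ∂σ =
      ∫⁻ y, ∫⁻ z, f (y + z) ∂(gaussianReal 0 v) ∂σ := by
  have hm : Measurable f := hf.measurable
  simp_rw [← lintegral_const_mul' _ _ ENNReal.coe_ne_top]
  rw [lintegral_lintegral_swap (by unfold Function.uncurry; fun_prop)]
  refine lintegral_congr fun y ↦ ?_
  rw [gaussianReal_of_var_ne_zero _ hv,
    lintegral_withDensity_eq_lintegral_mul _ (measurable_gaussianPDF 0 v) (by fun_prop),
    ← lintegral_add_right_eq_self _ y]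
  refine lintegral_congr fun x ↦ ?_
  simp [mul_comm, add_comm]

lemma tendsto_lintegral_gaussianReal_add (σ : Measure ℝ) [IsFiniteMeasure σ] {f : ℝ → ℝ≥0}
    (hf : Continuous f) (hf1 : ∀ x, f x ≤ 1) :
    Tendsto (fun n : ℕ ↦ ∫⁻ y, ∫⁻ z, f (y + z) ∂(gaussianReal 0 ((1 / (n + 1) : ℝ≥0) ^ 2)) ∂σ) atTop
      (𝓝 (∫⁻ y, f y ∂σ)) := by
  have hm : Measurable f := hf.measurable
  have h1 (n : ℕ) : ∫⁻ y, ∫⁻ z, f (y + z) ∂(gaussianReal 0 ((1 / (n + 1) : ℝ≥0) ^ 2)) ∂σ =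
      ∫⁻ p, f (p.1 + (1 / (n + 1) : ℝ) * p.2) ∂(σ.prod (gaussianReal 0 1)) := by
    rw [lintegral_prod _ (by fun_prop)]
    refine lintegral_congr fun y ↦ ?_
    have : gaussianReal 0 ((1 / (n + 1) : ℝ≥0) ^ 2) =
        (gaussianReal 0 1).map (fun x ↦ (1 / (n + 1) : ℝ) * x) := by
      rw [gaussianReal_map_const_mul]
      congr 1
      · simp
      · ext; simp
    rw [this, lintegral_map (by fun_prop) (by fun_prop)]
  have h2 : ∫⁻ y, f y ∂σ = ∫⁻ p : ℝ × ℝ, f p.1 ∂(σ.prod (gaussianReal 0 1)) := by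
    rw [lintegral_prod _ (by fun_prop)]
    simp
  simp_rw [h1, h2]
  refine tendsto_lintegral_of_dominated_convergence (fun _ ↦ 1) (fun n ↦ by fun_prop)
    (fun n ↦ ae_of_all _ fun p ↦ ?_) (by simp) (ae_of_all _ fun p ↦ ?_)
  · simpa using hf1 _
  · refine ENNReal.tendsto_coe.2 ((hf.tendsto _).comp ?_)
    simpa using (tendsto_one_div_add_atTop_nhds_zero_nat (𝕜 := ℝ)).mul_const p.2 |>.const_add p.1

/-- If the characteristic functions of `σ` and `τ` differ by at most `2πc` in `L¹`, then
`σ ≤ τ + c • volume`. With `τ = 0` this bounds the density of a measure whose characteristic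
function is integrable; with both measures absolutely continuous it compares densities. -/
theorem measure_le_add_smul_volume (σ τ : Measure ℝ) [IsFiniteMeasure σ]
    [IsFiniteMeasure τ] {c : ℝ≥0∞} (hc : c ≠ ⊤)
    (h : ∫⁻ s, ‖charFun σ s - charFun τ s‖ₑ ≤ ENNReal.ofReal (2 * Real.pi) * c) :
    σ ≤ τ + c • volume := by
  lift c to ℝ≥0 using hc
  have : IsLocallyFiniteMeasure ((c : ℝ≥0∞) • (volume : Measure ℝ)) :=
    inferInstanceAs (IsLocallyFiniteMeasure (c • (volume : Measure ℝ)))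
  have : IsLocallyFiniteMeasure (τ + (c : ℝ≥0∞) • (volume : Measure ℝ)) := by
    refine ⟨fun x ↦ ?_⟩
    refine ⟨Metric.ball x 1, Metric.ball_mem_nhds x one_pos, ?_⟩
    rw [Measure.add_apply]
    exact ENNReal.add_lt_top.2 ⟨measure_lt_top _ _, measure_ball_lt_top⟩
  refine measure_le_of_forall_lintegral_le fun f hf hf1 ↦ ?_
  have hm : Measurable f := hf.measurable
  rw [lintegral_add_measure, lintegral_smul_measure]
  refine le_of_tendsto_of_tendsto' (tendsto_lintegral_gaussianReal_add σ hf hf1)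
    ((tendsto_lintegral_gaussianReal_add τ hf hf1).add_const _) fun n ↦ ?_
  have hv : ((1 / (n + 1) : ℝ≥0) ^ 2) ≠ 0 := by positivity
  rw [← lintegral_lintegral_gaussianPDF_sub hv σ hf, ← lintegral_lintegral_gaussianPDF_sub hv τ hf,
    smul_eq_mul, ← lintegral_const_mul' _ _ ENNReal.coe_ne_top,
    ← lintegral_add_right _ (by fun_prop)]
  refine lintegral_mono fun x ↦ ?_
  calc (f x : ℝ≥0∞) * ∫⁻ y, gaussianPDF 0 _ (x - y) ∂σ
      ≤ f x * (∫⁻ y, gaussianPDF 0 _ (x - y) ∂τ + c) := by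
        gcongr; exact lintegral_gaussianPDF_sub_le hv σ τ h x
    _ = _ := by rw [mul_add, mul_comm (c : ℝ≥0∞)]

/-! ### Symmetrization -/

/-- The symmetrization of `σ`: the law of the difference of two independent variables with law `σ`
when `σ` is a probability measure. -/
noncomputable def symmetrization (σ : Measure ℝ) : Measure ℝ := σ ∗ σ.map (fun x ↦ (-1) * x)

instance (σ : Measure ℝ) [IsFiniteMeasure σ] : IsFiniteMeasure (symmetrization σ) := by
  unfold symmetrization; infer_instance

lemma charFun_symmetrization (σ : Measure ℝ) [IsFiniteMeasure σ] (s : ℝ) :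
    charFun (symmetrization σ) s = ((‖charFun σ s‖ ^ 2 : ℝ) : ℂ) := by
  rw [symmetrization, charFun_conv, charFun_map_mul, neg_one_mul, charFun_neg, Complex.mul_conj,
    Complex.normSq_eq_norm_sq]

lemma lintegral_symmetrization (σ : Measure ℝ) [IsFiniteMeasure σ] {f : ℝ → ℝ≥0∞}
    (hf : Measurable f) :
    ∫⁻ z, f z ∂(symmetrization σ) = ∫⁻ x, ∫⁻ y, f (x - y) ∂σ ∂σ := by
  rw [symmetrization, Measure.lintegral_conv hf]
  refine lintegral_congr fun x ↦ ?_
  rw [lintegral_map (by fun_prop) (by fun_prop)]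
  simp [sub_eq_add_neg]

/-! ### The Plancherel inequality -/

lemma lintegral_charFun_sq_mul_exp (σ : Measure ℝ) [IsFiniteMeasure σ] {v : ℝ≥0} (hv : v ≠ 0) :
    ∫⁻ s, ‖charFun σ s‖ₑ ^ 2 * ENNReal.ofReal (Real.exp (-(v / 2 : ℝ) * s ^ 2)) =
      ENNReal.ofReal (2 * Real.pi) * ∫⁻ x, ∫⁻ y, gaussianPDF 0 v (y - x) ∂σ ∂σ := by
  have h := integral_gaussianPDFReal_sub hv (symmetrization σ) 0
  have h1 : ∀ s : ℝ, charFun (symmetrization σ) s *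
      (Complex.exp (-(((0 : ℝ) : ℂ) * s * Complex.I)) * Complex.exp (-(v / 2 : ℝ) * s ^ 2)) =
      ((‖charFun σ s‖ ^ 2 * Real.exp (-(v / 2 : ℝ) * s ^ 2) : ℝ) : ℂ) := by
    intro s
    rw [charFun_symmetrization]
    simp
  have hi := integrable_charFun_mul_exp hv (symmetrization σ) 0
  simp_rw [h1] at h hi
  rw [integral_complex_ofReal, ← Complex.ofReal_mul, Complex.ofReal_inj] at h
  have h2 : ∫⁻ x, ∫⁻ y, gaussianPDF 0 v (y - x) ∂σ ∂σ =
      ∫⁻ z, gaussianPDF 0 v (0 - z) ∂(symmetrization σ) := by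
    rw [lintegral_symmetrization σ (by fun_prop)]
    simp
  rw [h2, lintegral_gaussianPDF_sub, h, ← ENNReal.ofReal_mul (by positivity),
    mul_inv_cancel_left₀ (by positivity), ofReal_integral_eq_lintegral_ofReal]
  · refine lintegral_congr fun s ↦ ?_
    rw [ENNReal.ofReal_mul (by positivity), ENNReal.ofReal_pow (norm_nonneg _), ofReal_norm]
  · simpa only [RCLike.re_eq_complex_re, Complex.ofReal_re] using hi.re
  · exact ae_of_all _ fun s ↦ by positivity

lemma mul_le_add_sq_div_two (a b : ℝ≥0∞) : a * b ≤ (a ^ 2 + b ^ 2) / 2 := by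
  rcases eq_or_ne a ⊤ with rfl | ha
  · simp [ENNReal.top_div]
  rcases eq_or_ne b ⊤ with rfl | hb
  · simp [ENNReal.top_div]
  lift a to ℝ≥0 using ha
  lift b to ℝ≥0 using hb
  rw [ENNReal.le_div_iff_mul_le (by simp) (by simp)]
  norm_cast
  have := two_mul_le_add_sq a b
  linarith [mul_comm (a * b) 2, mul_assoc 2 a b]

/-- One half of Plancherel's theorem for nonnegative functions in `L¹ ∩ L²`, with a proof that
needs only the Gaussian kernel. -/
theorem lintegral_charFun_sq_le {g : ℝ → ℝ≥0∞} (hg : Measurable g)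
    [IsFiniteMeasure ((volume : Measure ℝ).withDensity g)] :
    ∫⁻ s, ‖charFun (volume.withDensity g) s‖ₑ ^ 2 ≤
      ENNReal.ofReal (2 * Real.pi) * ∫⁻ x, g x ^ 2 := by
  set σ := (volume : Measure ℝ).withDensity g with hσ
  have key (v : ℝ≥0) (hv : v ≠ 0) :
      ∫⁻ x, ∫⁻ y, gaussianPDF 0 v (y - x) ∂σ ∂σ ≤ ∫⁻ x, g x ^ 2 := by
    have hG : ∀ x, ∫⁻ y, gaussianPDF 0 v (y - x) = 1 := fun x ↦ by
      rw [lintegral_sub_right_eq_self (fun y ↦ gaussianPDF 0 v y) x,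
        lintegral_gaussianPDF_eq_one 0 hv]
    have hG' : ∀ y, ∫⁻ x, gaussianPDF 0 v (y - x) = 1 := fun y ↦ by
      rw [lintegral_sub_left_eq_self (fun y ↦ gaussianPDF 0 v y) y,
        lintegral_gaussianPDF_eq_one 0 hv]
    calc ∫⁻ x, ∫⁻ y, gaussianPDF 0 v (y - x) ∂σ ∂σ
        = ∫⁻ x, ∫⁻ y, (g x * g y) * gaussianPDF 0 v (y - x) := by
          rw [hσ, lintegral_withDensity_eq_lintegral_mul _ hg (by fun_prop)]
          refine lintegral_congr fun x ↦ ?_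
          rw [Pi.mul_apply, lintegral_withDensity_eq_lintegral_mul _ hg (by fun_prop),
            ← lintegral_const_mul _ (by fun_prop)]
          simp [mul_assoc]
      _ ≤ ∫⁻ x, ∫⁻ y, ((g x ^ 2 / 2) * gaussianPDF 0 v (y - x) +
            (g y ^ 2 / 2) * gaussianPDF 0 v (y - x)) := by
          refine lintegral_mono fun x ↦ lintegral_mono fun y ↦ ?_
          simp only
          rw [← add_mul, ← ENNReal.add_div]
          gcongr
          exact mul_le_add_sq_div_two _ _
      _ = (∫⁻ x, g x ^ 2 / 2) + ∫⁻ y, g y ^ 2 / 2 := by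
          have h1 (x : ℝ) : ∫⁻ y, ((g x ^ 2 / 2) * gaussianPDF 0 v (y - x) +
              (g y ^ 2 / 2) * gaussianPDF 0 v (y - x)) =
              (∫⁻ y, (g x ^ 2 / 2) * gaussianPDF 0 v (y - x)) +
              ∫⁻ y, (g y ^ 2 / 2) * gaussianPDF 0 v (y - x) := lintegral_add_left (by fun_prop) _
          simp_rw [h1]
          rw [lintegral_add_left (by fun_prop)]
          congr 1
          · refine lintegral_congr fun x ↦ ?_
            rw [lintegral_const_mul _ (by fun_prop), hG, mul_one]
          · rw [lintegral_lintegral_swap (by fun_prop)]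
            refine lintegral_congr fun y ↦ ?_
            rw [lintegral_const_mul _ (by fun_prop), hG', mul_one]
      _ = ∫⁻ x, g x ^ 2 := by
          rw [← lintegral_add_left (hg.pow_const 2 |>.div_const 2)]
          simp
  have hlim (s : ℝ) : Tendsto (fun n : ℕ ↦ ‖charFun σ s‖ₑ ^ 2 *
      ENNReal.ofReal (Real.exp (-(((1 / (n + 1) : ℝ≥0) : ℝ) / 2) * s ^ 2))) atTop
      (𝓝 (‖charFun σ s‖ₑ ^ 2)) := by
    have h0 : Tendsto (fun n : ℕ ↦ Real.exp (-(((1 / (n + 1) : ℝ≥0) : ℝ) / 2) * s ^ 2)) atTop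
        (𝓝 1) := by
      have := (tendsto_one_div_add_atTop_nhds_zero_nat (𝕜 := ℝ)).div_const 2
        |>.neg.mul_const (s ^ 2)
      simpa [Function.comp_def] using (Real.continuous_exp.tendsto _).comp this
    have h1 := ENNReal.tendsto_ofReal h0
    rw [ENNReal.ofReal_one] at h1
    simpa using ENNReal.Tendsto.const_mul h1 (Or.inl one_ne_zero) (a := ‖charFun σ s‖ₑ ^ 2)
  calc ∫⁻ s, ‖charFun σ s‖ₑ ^ 2
      = ∫⁻ s, liminf (fun n : ℕ ↦ ‖charFun σ s‖ₑ ^ 2 *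
        ENNReal.ofReal (Real.exp (-(((1 / (n + 1) : ℝ≥0) : ℝ) / 2) * s ^ 2))) atTop :=
        lintegral_congr fun s ↦ (hlim s).liminf_eq.symm
    _ ≤ liminf (fun n : ℕ ↦ ∫⁻ s, ‖charFun σ s‖ₑ ^ 2 *
        ENNReal.ofReal (Real.exp (-(((1 / (n + 1) : ℝ≥0) : ℝ) / 2) * s ^ 2))) atTop :=
        lintegral_liminf_le fun n ↦ by fun_prop
    _ ≤ liminf (fun _ : ℕ ↦ ENNReal.ofReal (2 * Real.pi) * ∫⁻ x, g x ^ 2) atTop := by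
        refine liminf_le_liminf (Eventually.of_forall fun n ↦ ?_)
        rw [lintegral_charFun_sq_mul_exp σ (v := 1 / (n + 1)) (by positivity)]
        exact mul_le_mul' le_rfl (key (1 / (n + 1)) (by positivity))
    _ = _ := by simp

/-! ### The defect of the characteristic function -/

/-- The defect of `|charFun|²` from its value at `0` is an integral of a nonnegative function over
the symmetrization; hence it is monotone in the measure. -/
lemma lintegral_lintegral_one_sub_cos (σ : Measure ℝ) [IsFiniteMeasure σ] (s : ℝ) :
    ∫⁻ x, ∫⁻ y, ENNReal.ofReal (1 - Real.cos (s * (x - y))) ∂σ ∂σ =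
      ENNReal.ofReal (σ.real Set.univ ^ 2 - ‖charFun σ s‖ ^ 2) := by
  rw [← lintegral_symmetrization σ (f := fun z ↦ ENNReal.ofReal (1 - Real.cos (s * z)))
    (by fun_prop)]
  have hcos : Integrable (fun z ↦ Real.cos (s * z)) (symmetrization σ) :=
    Integrable.of_bound (C := 1) (Measurable.aestronglyMeasurable (by fun_prop))
      (ae_of_all _ fun z ↦ Real.abs_cos_le_one _)
  have hexp : Integrable (fun z : ℝ ↦ Complex.exp (s * z * Complex.I)) (symmetrization σ) :=
    Integrable.of_bound (C := 1) (Measurable.aestronglyMeasurable (by fun_prop))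
      (ae_of_all _ fun z ↦ by rw [Complex.norm_exp]; simp)
  rw [← ofReal_integral_eq_lintegral_ofReal (f := fun z ↦ 1 - Real.cos (s * z))
    ((integrable_const _).sub hcos)
    (ae_of_all _ fun z ↦ by simpa using Real.cos_le_one _)]
  congr 1
  have h0 : (symmetrization σ).real Set.univ = σ.real Set.univ ^ 2 := by
    have h := charFun_symmetrization σ 0
    rw [charFun_zero, charFun_zero, Complex.ofReal_inj] at h
    rw [h, Complex.norm_real, Real.norm_of_nonneg measureReal_nonneg]
  have hs : ∫ z, Real.cos (s * z) ∂(symmetrization σ) = ‖charFun σ s‖ ^ 2 := by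
    have h := congrArg Complex.re (charFun_symmetrization σ s)
    rw [Complex.ofReal_re, charFun_apply_real] at h
    rw [← h]
    change _ = RCLike.re (K := ℂ) _
    rw [← integral_re hexp]
    refine integral_congr_ae (ae_of_all _ fun z ↦ ?_)
    change _ = (Complex.exp (s * z * Complex.I)).re
    rw [← Complex.ofReal_mul, Complex.exp_ofReal_mul_I_re]
  rw [integral_sub (integrable_const _) hcos, hs, integral_const, h0]
  simp

lemma charFun_sq_le (σ : Measure ℝ) [IsFiniteMeasure σ] (s : ℝ) :
    ‖charFun σ s‖ ^ 2 ≤ σ.real Set.univ ^ 2 :=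
  pow_le_pow_left₀ (norm_nonneg _) (norm_charFun_le s) 2

/-- The defect of `|charFun|²` is quadratically monotone in the measure. -/
lemma defect_mono {σ τ : Measure ℝ} [IsFiniteMeasure σ] [IsFiniteMeasure τ] {c : ℝ} (hc : 0 ≤ c)
    (h : ENNReal.ofReal c • σ ≤ τ) (s : ℝ) :
    c ^ 2 * (σ.real Set.univ ^ 2 - ‖charFun σ s‖ ^ 2) ≤
      τ.real Set.univ ^ 2 - ‖charFun τ s‖ ^ 2 := by
  rw [← ENNReal.ofReal_le_ofReal_iff (sub_nonneg.2 (charFun_sq_le τ s)),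
    ENNReal.ofReal_mul (by positivity),
    ← lintegral_lintegral_one_sub_cos, ← lintegral_lintegral_one_sub_cos, ENNReal.ofReal_pow hc]
  calc _ = ∫⁻ x, ∫⁻ y, ENNReal.ofReal (1 - Real.cos (s * (x - y))) ∂(ENNReal.ofReal c • σ)
        ∂(ENNReal.ofReal c • σ) := by
        simp_rw [lintegral_smul_measure, smul_eq_mul]
        rw [lintegral_const_mul' _ _ ENNReal.ofReal_ne_top, ← mul_assoc, sq]
    _ ≤ _ := lintegral_mono' h fun x ↦ lintegral_mono' h le_rfl

/-- The doubling inequality, which follows from `1 - cos (2u) ≤ 4 (1 - cos u)`. -/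
lemma defect_two_mul_le (σ : Measure ℝ) [IsFiniteMeasure σ] (s : ℝ) :
    σ.real Set.univ ^ 2 - ‖charFun σ (2 * s)‖ ^ 2 ≤
      4 * (σ.real Set.univ ^ 2 - ‖charFun σ s‖ ^ 2) := by
  have h4 := sub_nonneg.2 (charFun_sq_le σ s)
  rw [← ENNReal.ofReal_le_ofReal_iff (by positivity), ENNReal.ofReal_mul (by positivity),
    ← lintegral_lintegral_one_sub_cos, ← lintegral_lintegral_one_sub_cos,
    ← lintegral_const_mul' _ _ ENNReal.ofReal_ne_top]
  refine lintegral_mono fun x ↦ ?_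
  rw [← lintegral_const_mul' _ _ ENNReal.ofReal_ne_top]
  refine lintegral_mono fun y ↦ ?_
  simp only
  rw [← ENNReal.ofReal_mul (by positivity)]
  refine ENNReal.ofReal_le_ofReal ?_
  rw [mul_assoc, Real.cos_two_mul]
  nlinarith [sq_nonneg (Real.cos (s * (x - y)) - 1)]

lemma tendsto_charFun_withDensity_cocompact {g : ℝ → ℝ} (hg : Measurable g) (hg0 : ∀ x, 0 ≤ g x) :
    Tendsto (charFun ((volume : Measure ℝ).withDensity fun x ↦ ENNReal.ofReal (g x)))
      (cocompact ℝ) (𝓝 0) := by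
  have h := Real.tendsto_integral_exp_smul_cocompact (fun x ↦ (g x : ℂ))
  have hm : Tendsto (fun s : ℝ ↦ -(2 * Real.pi)⁻¹ * s) (cocompact ℝ) (cocompact ℝ) :=
    (Homeomorph.mulLeft₀ (-(2 * Real.pi)⁻¹) (by
      exact neg_ne_zero.2 (by positivity))).isClosedEmbedding.tendsto_cocompact
  refine (h.comp hm).congr fun s ↦ ?_
  rw [charFun_apply_real, integral_withDensity_eq_integral_toReal_smul (by fun_prop)
    (ae_of_all _ fun _ ↦ ENNReal.ofReal_lt_top)]
  refine integral_congr_ae (ae_of_all _ fun x ↦ ?_)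
  simp only [Circle.smul_def, Real.fourierChar_apply, ENNReal.toReal_ofReal (hg0 x),
    Complex.real_smul, smul_eq_mul]
  rw [mul_comm]
  congr 2
  push_cast
  field_simp

/-- The characteristic function of an absolutely continuous measure stays away from its value at
`0`: far from `0` by the Riemann–Lebesgue lemma, and near `0` by repeated doubling. -/
theorem exists_defect_ge (σ : Measure ℝ) [IsFiniteMeasure σ] (hσ : σ ≪ volume)
    (hσ0 : σ ≠ 0) :
    ∃ κ > 0, ∀ s : ℝ, κ * min 1 (s ^ 2) ≤ σ.real Set.univ ^ 2 - ‖charFun σ s‖ ^ 2 := by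
  set m := σ.real Set.univ with hm
  have hm0 : 0 < m := by
    rw [hm, measureReal_def, ENNReal.toReal_pos_iff]
    exact ⟨by simpa [pos_iff_ne_zero] using hσ0, measure_lt_top _ _⟩
  have hlim : Tendsto (charFun σ) (cocompact ℝ) (𝓝 0) := by
    have h := tendsto_charFun_withDensity_cocompact (g := fun x ↦ (σ.rnDeriv volume x).toReal)
      (by fun_prop) (fun x ↦ ENNReal.toReal_nonneg)
    have h1 : (volume : Measure ℝ).withDensity
        (fun x ↦ ENNReal.ofReal (σ.rnDeriv volume x).toReal) = σ := by
      conv_rhs => rw [← Measure.withDensity_rnDeriv_eq σ volume hσ]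
      refine withDensity_congr_ae ?_
      filter_upwards [Measure.rnDeriv_lt_top σ volume] with x hx
      rw [ENNReal.ofReal_toReal hx.ne]
    rwa [h1] at h
  have hev : ∀ᶠ s in cocompact ℝ, ‖charFun σ s‖ < m / 2 := by
    simpa using hlim.norm.eventually_lt_const (by simpa using half_pos hm0)
  rw [← Metric.cobounded_eq_cocompact, ← comap_norm_atTop, eventually_comap] at hev
  obtain ⟨S₀, hS₀⟩ := eventually_atTop.1 hev
  set S := max S₀ 1 with hS
  have hS1 : 1 ≤ S := le_max_right _ _
  have hfar : ∀ s : ℝ, S ≤ |s| → m ^ 2 / 2 ≤ m ^ 2 - ‖charFun σ s‖ ^ 2 := by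
    intro s hs
    have h1 := hS₀ |s| ((le_max_left _ _).trans hs) s rfl
    nlinarith [norm_nonneg (charFun σ s)]
  -- The factor `8` leaves room for one doubling step across the radius `S`.
  set κ := m ^ 2 / (8 * S ^ 2) with hκ
  have hκ0 : 0 < κ := by positivity
  have hκS : 4 * κ * S ^ 2 = m ^ 2 / 2 := by rw [hκ]; field_simp; norm_num
  have hnear : ∀ j : ℕ, ∀ s : ℝ, S ≤ 2 ^ j * |s| → |s| < S →
      κ * s ^ 2 ≤ m ^ 2 - ‖charFun σ s‖ ^ 2 := by
    intro j
    induction j with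
    | zero => intro s h1 h2; simp at h1; linarith
    | succ j ih =>
      intro s h1 h2
      have hd := defect_two_mul_le σ s
      have habs : |2 * s| = 2 * |s| := by rw [abs_mul]; simp
      rcases le_or_gt S |2 * s| with h3 | h3
      · have h4 := hfar _ h3
        have : s ^ 2 ≤ S ^ 2 := sq_le_sq.2 (by rw [abs_of_pos (by linarith : 0 < S)]; exact h2.le)
        nlinarith
      · have h4 := ih (2 * s) (by rw [habs]; rw [pow_succ] at h1; linarith) h3
        nlinarith
  refine ⟨κ, hκ0, fun s ↦ ?_⟩
  rcases le_or_gt S |s| with h | h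
  · have h1 := hfar s h
    have h2 : κ * min 1 (s ^ 2) ≤ κ * 1 := by gcongr; exact min_le_left _ _
    nlinarith [one_le_pow₀ hS1 (n := 2)]
  · rcases eq_or_ne s 0 with rfl | hs
    · calc κ * min 1 (0 ^ 2) = 0 := by simp
        _ ≤ _ := sub_nonneg.2 (charFun_sq_le σ 0)
    · have hs' : 0 < |s| := abs_pos.2 hs
      obtain ⟨j, hj⟩ := pow_unbounded_of_one_lt (S / |s|) (one_lt_two (α := ℝ))
      refine le_trans ?_ (hnear j s ((div_le_iff₀ hs').1 hj.le) h)
      gcongr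
      exact min_le_right _ _

/-! ### Exponential tilting -/

/-- The unnormalized exponential tilt `e^{hx} ν(dx)`. Its characteristic function is the complex
moment generating function of `ν` on the vertical line through `h`. -/
noncomputable def expTilt (ν : Measure ℝ) (h : ℝ) : Measure ℝ :=
  ν.withDensity fun x ↦ ENNReal.ofReal (Real.exp (h * x))

lemma isFiniteMeasure_expTilt {ν : Measure ℝ} {h : ℝ}
    (hint : Integrable (fun x ↦ Real.exp (h * x)) ν) : IsFiniteMeasure (expTilt ν h) :=
  isFiniteMeasure_withDensity_ofReal hint.2

lemma charFun_expTilt (ν : Measure ℝ) (h s : ℝ) :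
    charFun (expTilt ν h) s = complexMGF id ν (h + s * Complex.I) := by
  rw [charFun_apply_real, expTilt, integral_withDensity_eq_integral_toReal_smul (by fun_prop)
    (ae_of_all _ fun _ ↦ ENNReal.ofReal_lt_top), complexMGF]
  refine integral_congr_ae (ae_of_all _ fun x ↦ ?_)
  simp only [ENNReal.toReal_ofReal (Real.exp_pos _).le, Complex.real_smul, id]
  rw [Complex.ofReal_exp, ← Complex.exp_add]
  congr 1
  push_cast
  ring

lemma measureReal_univ_expTilt {ν : Measure ℝ} {h : ℝ}
    (hint : Integrable (fun x ↦ Real.exp (h * x)) ν) :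
    (expTilt ν h).real Set.univ = mgf id ν h := by
  rw [measureReal_def, expTilt, withDensity_apply _ MeasurableSet.univ, Measure.restrict_univ,
    ← ofReal_integral_eq_lintegral_ofReal hint (ae_of_all _ fun _ ↦ (Real.exp_pos _).le),
    ENNReal.toReal_ofReal (integral_nonneg fun _ ↦ (Real.exp_pos _).le)]
  rfl

lemma measurable_complexMGF_line (ν : Measure ℝ) [SFinite ν] (h : ℝ) :
    Measurable fun s : ℝ ↦ complexMGF id ν (h + s * Complex.I) := by
  simp_rw [← charFun_expTilt]
  have : SFinite (expTilt ν h) := by unfold expTilt; infer_instance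
  fun_prop

lemma ofReal_exp_mul_gaussianPDF_le (h x : ℝ) :
    ENNReal.ofReal (Real.exp (h * x)) ^ 2 * gaussianPDF 0 1 x ≤
      ENNReal.ofReal (Real.exp (2 * h ^ 2)) := by
  rw [gaussianPDF, ← ENNReal.ofReal_pow (Real.exp_pos _).le, ← ENNReal.ofReal_mul (by positivity)]
  refine ENNReal.ofReal_le_ofReal ?_
  have h1 : (√(2 * Real.pi * (1 : ℝ≥0)))⁻¹ ≤ 1 := by
    refine inv_le_one_of_one_le₀ (Real.one_le_sqrt.2 ?_)
    push_cast
    nlinarith [Real.pi_gt_three]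
  rw [gaussianPDFReal, ← Real.exp_nat_mul]
  calc Real.exp ((2 : ℕ) * (h * x)) *
        ((√(2 * Real.pi * (1 : ℝ≥0)))⁻¹ * Real.exp (-(x - 0) ^ 2 / (2 * (1 : ℝ≥0))))
      ≤ Real.exp ((2 : ℕ) * (h * x)) * (1 * Real.exp (-(x - 0) ^ 2 / (2 * (1 : ℝ≥0)))) := by
        gcongr
    _ = Real.exp ((2 : ℕ) * (h * x) + -(x - 0) ^ 2 / (2 * (1 : ℝ≥0))) := by
        rw [one_mul, Real.exp_add]
    _ ≤ Real.exp (2 * h ^ 2) := by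
        refine Real.exp_le_exp.2 ?_
        push_cast
        nlinarith [sq_nonneg (x - 2 * h)]

/-- A finite `χ²`-type integral against the Gaussian controls the `L²` norm of the complex moment
generating function on every vertical line. -/
theorem lintegral_complexMGF_sq_le {ν : Measure ℝ} [IsFiniteMeasure ν] (hν : ν ≪ volume) {h : ℝ}
    (hint : Integrable (fun x ↦ Real.exp (h * x)) ν) :
    ∫⁻ s : ℝ, ‖complexMGF id ν (h + s * Complex.I)‖ₑ ^ 2 ≤
      ENNReal.ofReal (2 * Real.pi) * (ENNReal.ofReal (Real.exp (2 * h ^ 2)) *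
        ∫⁻ x, (ν.rnDeriv volume x / gaussianPDF 0 1 x) ^ 2 * gaussianPDF 0 1 x) := by
  set p := ν.rnDeriv volume with hp
  have hpm : Measurable p := Measure.measurable_rnDeriv _ _
  have hdens : expTilt ν h =
      volume.withDensity (fun x ↦ p x * ENNReal.ofReal (Real.exp (h * x))) := by
    rw [expTilt]
    conv_lhs => rw [← Measure.withDensity_rnDeriv_eq ν volume hν]
    exact (withDensity_mul _ hpm (by fun_prop)).symm
  have hfin := isFiniteMeasure_expTilt hint
  simp_rw [← charFun_expTilt]
  rw [hdens] at hfin ⊢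
  refine (lintegral_charFun_sq_le (by fun_prop)).trans (mul_le_mul' le_rfl ?_)
  rw [← lintegral_const_mul _ (by fun_prop)]
  refine lintegral_mono fun x ↦ ?_
  have hx : p x = p x / gaussianPDF 0 1 x * gaussianPDF 0 1 x :=
    (ENNReal.div_mul_cancel (gaussianPDF_pos 0 one_ne_zero x).ne' gaussianPDF_ne_top).symm
  calc (p x * ENNReal.ofReal (Real.exp (h * x))) ^ 2
      = (ENNReal.ofReal (Real.exp (h * x)) ^ 2 * gaussianPDF 0 1 x) *
        ((p x / gaussianPDF 0 1 x) ^ 2 * gaussianPDF 0 1 x) := by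
        conv_lhs => rw [hx]
        ring
    _ ≤ _ := by gcongr; exact ofReal_exp_mul_gaussianPDF_le h x

/-- The defect of the characteristic functions of all exponential tilts of an absolutely
continuous measure is bounded below at once, by restriction to a compact interval. -/
theorem exists_complexMGF_defect_ge {ν : Measure ℝ} [IsFiniteMeasure ν] (hν : ν ≪ volume)
    (hν0 : ν ≠ 0) (hint : ∀ h : ℝ, Integrable (fun x ↦ Real.exp (h * x)) ν) :
    ∃ κ > 0, ∃ R : ℝ, ∀ h s : ℝ, Real.exp (-(2 * |h| * R)) * (κ * min 1 (s ^ 2)) ≤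
      mgf id ν h ^ 2 - ‖complexMGF id ν (h + s * Complex.I)‖ ^ 2 := by
  obtain ⟨R, hR⟩ : ∃ R : ℕ, ν.restrict (Set.Icc (-R : ℝ) R) ≠ 0 := by
    by_contra! hcon
    refine hν0 (Measure.measure_univ_eq_zero.1 ?_)
    have hU : (Set.univ : Set ℝ) = ⋃ R : ℕ, Set.Icc (-R : ℝ) R := by
      ext x
      obtain ⟨n, hn⟩ := exists_nat_ge |x|
      simpa using ⟨n, abs_le.1 hn⟩
    rw [hU]
    exact measure_iUnion_null fun R ↦ Measure.restrict_eq_zero.1 (hcon R)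
  obtain ⟨κ, hκ, hdef⟩ := exists_defect_ge (ν.restrict (Set.Icc (-R : ℝ) R))
    (Measure.restrict_le_self.absolutelyContinuous.trans hν) hR
  refine ⟨κ, hκ, R, fun h s ↦ ?_⟩
  have := isFiniteMeasure_expTilt (hint h)
  have hle : ENNReal.ofReal (Real.exp (-(|h| * R))) • ν.restrict (Set.Icc (-R : ℝ) R) ≤
      expTilt ν h := by
    rw [← withDensity_const, ← withDensity_indicator measurableSet_Icc, expTilt]
    refine withDensity_mono (ae_of_all _ fun x ↦ ?_)
    by_cases hx : x ∈ Set.Icc (-R : ℝ) R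
    · rw [Set.indicator_of_mem hx]
      refine ENNReal.ofReal_le_ofReal (Real.exp_le_exp.2 ?_)
      have h1 : |h * x| ≤ |h| * R := by
        rw [abs_mul]; gcongr; exact abs_le.2 hx
      exact neg_le_of_abs_le h1
    · simp [hx]
  have hm := defect_mono (Real.exp_pos _).le hle s
  rw [measureReal_univ_expTilt (hint h), charFun_expTilt] at hm
  refine le_trans ?_ hm
  rw [← Real.exp_nat_mul]
  have : Real.exp ((2 : ℕ) * -(|h| * R)) = Real.exp (-(2 * |h| * R)) := by
    congr 1; push_cast; ring
  rw [this]
  exact mul_le_mul_of_nonneg_left (hdef s) (Real.exp_pos _).le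

/-! ### Powers of functions bounded away from one -/

lemma pow_succ_le_exp_add {q b s : ℝ} (k : ℕ) (hq0 : 0 ≤ q)
    (hq : q ≤ 1 - b * min 1 (s ^ 2)) :
    q ^ (k + 1) ≤ Real.exp (-(b * (k + 1)) * s ^ 2) + Real.exp (-(b * k)) * q := by
  rcases le_total 1 (s ^ 2) with h | h
  · rw [min_eq_left h, mul_one] at hq
    have h1 : q ≤ Real.exp (-b) := hq.trans (by linarith [Real.add_one_le_exp (-b)])
    have h2 : q ^ k ≤ Real.exp (-(b * k)) := by
      calc q ^ k ≤ Real.exp (-b) ^ k := by gcongr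
        _ = _ := by rw [← Real.exp_nat_mul]; congr 1; ring
    rw [pow_succ]
    have := mul_le_mul_of_nonneg_right h2 hq0
    linarith [Real.exp_pos (-(b * (k + 1)) * s ^ 2)]
  · rw [min_eq_right h] at hq
    have h1 : q ≤ Real.exp (-(b * s ^ 2)) :=
      hq.trans (by linarith [Real.add_one_le_exp (-(b * s ^ 2))])
    have h2 : q ^ (k + 1) ≤ Real.exp (-(b * (k + 1)) * s ^ 2) := by
      calc q ^ (k + 1) ≤ Real.exp (-(b * s ^ 2)) ^ (k + 1) := by gcongr
        _ = _ := by rw [← Real.exp_nat_mul]; congr 1; push_cast; ring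
    have := mul_nonneg (Real.exp_pos (-(b * k))).le hq0
    linarith

/-- The number `n / N - 1` of spare blocks of length `N` in `n` is of order `n`. -/
lemma exists_block_decomposition {N n : ℕ} (hN : 1 ≤ N) (hn : 2 * N ≤ n) :
    ∃ k : ℕ, N * (k + 1) ≤ n ∧ (n : ℝ) ≤ 4 * N * k := by
  obtain ⟨k, hk⟩ : ∃ k, n / N = k + 2 := Nat.exists_eq_add_of_le' ((Nat.le_div_iff_mul_le hN).2 hn)
  refine ⟨k + 1, ?_, ?_⟩
  · have := Nat.div_mul_le_self n N
    rw [hk] at this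
    nlinarith
  · have h1 : n < N * (n / N + 1) := by
      have := Nat.lt_mul_div_succ n hN
      simpa using this
    rw [hk] at h1
    have h2 : n ≤ 4 * N * (k + 1) := by nlinarith
    exact_mod_cast h2

lemma pow_le_exp_add {K b s : ℝ} {N n k : ℕ} (hK0 : 0 ≤ K) (hK1 : K ≤ 1)
    (hK : K ^ N ≤ 1 - b * min 1 (s ^ 2)) (hk : N * (k + 1) ≤ n) :
    K ^ n ≤ Real.exp (-(b * (k + 1)) * s ^ 2) + Real.exp (-(b * k)) * K ^ N := by
  refine le_trans ?_ (pow_succ_le_exp_add k (pow_nonneg hK0 N) hK)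
  rw [← pow_mul]
  exact pow_le_pow_of_le_one hK0 hK1 hk

lemma lintegral_exp_neg_mul_sq {b : ℝ} (hb : 0 < b) :
    ∫⁻ s : ℝ, ENNReal.ofReal (Real.exp (-b * s ^ 2)) = ENNReal.ofReal (√(Real.pi / b)) := by
  rw [← integral_gaussian, ofReal_integral_eq_lintegral_ofReal (integrable_exp_neg_mul_sq hb)
    (ae_of_all _ fun _ ↦ (Real.exp_pos _).le)]

lemma exp_neg_le_inv_sqrt {y : ℝ} (hy : 0 < y) : Real.exp (-y) ≤ (√y)⁻¹ := by
  rw [Real.exp_neg]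
  refine inv_anti₀ (Real.sqrt_pos.2 hy) ?_
  rw [Real.sqrt_le_iff]
  refine ⟨(Real.exp_pos _).le, ?_⟩
  nlinarith [Real.add_one_le_exp y]

/-- If `K^N` is integrable and stays below `1` quadratically near `0` and uniformly away from it,
then the integral of `K^n` decays like `n^{-1/2}`. -/
theorem lintegral_pow_le {K : ℝ → ℝ} {A b : ℝ} {N n : ℕ} (hN : 1 ≤ N)
    (hn : 2 * N ≤ n) (hKm : Measurable K) (hK0 : ∀ s, 0 ≤ K s) (hK1 : ∀ s, K s ≤ 1) (hb : 0 < b)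
    (hA : 0 ≤ A) (hK : ∀ s, K s ^ N ≤ 1 - b * min 1 (s ^ 2))
    (hKA : ∫⁻ s, ENNReal.ofReal (K s ^ N) ≤ ENNReal.ofReal A) :
    ∫⁻ s, ENNReal.ofReal (K s ^ n) ≤ ENNReal.ofReal ((2 + A) * √(4 * N / b) / √n) := by
  obtain ⟨k, hk, hkn⟩ := exists_block_decomposition hN hn
  have hn0 : (0 : ℝ) < n := by exact_mod_cast (by omega : 0 < n)
  have hN0 : (0 : ℝ) < N := by exact_mod_cast hN
  have hk0 : (0 : ℝ) < k := by
    rcases Nat.eq_zero_or_pos k with rfl | h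
    · simp at hkn; linarith
    · exact_mod_cast h
  have h1 : √(4 * N / b) / √n = (√(b * n / (4 * N)))⁻¹ := by
    rw [← Real.sqrt_div (by positivity), ← Real.sqrt_inv]
    congr 1
    field_simp
  have hnk : b * n / (4 * N) ≤ b * k := by
    rw [div_le_iff₀ (by positivity)]
    nlinarith
  have hkey : (√(b * k))⁻¹ ≤ √(4 * N / b) / √n := by
    rw [h1]
    exact inv_anti₀ (Real.sqrt_pos.2 (by positivity)) (Real.sqrt_le_sqrt hnk)
  calc ∫⁻ s, ENNReal.ofReal (K s ^ n)
      ≤ ∫⁻ s, (ENNReal.ofReal (Real.exp (-(b * (k + 1)) * s ^ 2)) +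
          ENNReal.ofReal (Real.exp (-(b * k))) * ENNReal.ofReal (K s ^ N)) := by
        refine lintegral_mono fun s ↦ ?_
        simp only
        rw [← ENNReal.ofReal_mul (Real.exp_pos _).le, ← ENNReal.ofReal_add (Real.exp_pos _).le
          (mul_nonneg (Real.exp_pos _).le (pow_nonneg (hK0 s) N))]
        exact ENNReal.ofReal_le_ofReal (pow_le_exp_add (hK0 s) (hK1 s) (hK s) hk)
    _ ≤ ENNReal.ofReal (√(Real.pi / (b * (k + 1)))) +
          ENNReal.ofReal (Real.exp (-(b * k))) * ENNReal.ofReal A := by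
        rw [lintegral_add_left (by fun_prop), lintegral_const_mul _ (by fun_prop),
          lintegral_exp_neg_mul_sq (by positivity)]
        gcongr
    _ ≤ ENNReal.ofReal ((2 + A) * √(4 * N / b) / √n) := by
        rw [← ENNReal.ofReal_mul (Real.exp_pos _).le, ← ENNReal.ofReal_add (by positivity)
          (by positivity)]
        refine ENNReal.ofReal_le_ofReal ?_
        have h2 : √(Real.pi / (b * (k + 1))) ≤ 2 * (√(b * k))⁻¹ := by
          rw [Real.sqrt_div Real.pi_pos.le, div_eq_mul_inv]
          have h3 : √Real.pi ≤ 2 := by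
            rw [Real.sqrt_le_left (by norm_num)]
            linarith [Real.pi_le_four]
          have h4 : (√(b * (k + 1)))⁻¹ ≤ (√(b * k))⁻¹ :=
            inv_anti₀ (Real.sqrt_pos.2 (by positivity)) (Real.sqrt_le_sqrt (by nlinarith))
          gcongr
        have h5 := exp_neg_le_inv_sqrt (show 0 < b * k by positivity)
        have h6 : Real.exp (-(b * k)) * A ≤ (√(b * k))⁻¹ * A := by gcongr
        calc _ ≤ (2 + A) * (√(b * k))⁻¹ := by linarith
          _ ≤ (2 + A) * (√(4 * N / b) / √n) := by gcongr
          _ = _ := by ring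

/-! ### The normalized moment generating function on vertical lines -/

/-- The modulus of the characteristic function of the normalized exponential tilt of `μ` with
parameter `t`. -/
noncomputable def tiltedNorm (μ : Measure ℝ) (t s : ℝ) : ℝ :=
  ‖complexMGF id μ (t + s * Complex.I)‖ / mgf id μ t

lemma tiltedNorm_nonneg (μ : Measure ℝ) (t s : ℝ) : 0 ≤ tiltedNorm μ t s :=
  div_nonneg (norm_nonneg _) mgf_nonneg

lemma tiltedNorm_le_one (μ : Measure ℝ) (t s : ℝ) : tiltedNorm μ t s ≤ 1 := by
  refine div_le_one_of_le₀ ?_ mgf_nonneg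
  simpa using norm_complexMGF_le_mgf (X := id) (μ := μ) (z := t + s * Complex.I)

lemma measurable_tiltedNorm (μ : Measure ℝ) [SFinite μ] (t : ℝ) : Measurable (tiltedNorm μ t) :=
  (measurable_complexMGF_line μ t).norm.div_const _

lemma lintegral_comp_mul_left {f : ℝ → ℝ≥0∞} (hf : Measurable f) {a : ℝ} (ha : 0 < a) :
    ∫⁻ s, f (a * s) = ENNReal.ofReal a⁻¹ * ∫⁻ s, f s := by
  rw [← lintegral_map hf (measurable_const_mul a), Real.map_volume_mul_left ha.ne',
    lintegral_smul_measure, abs_of_pos (inv_pos.2 ha), smul_eq_mul]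

/-- `ν` is the law of the normalized sum of `m` independent variables with law `μ`, in terms of
complex moment generating functions. -/
def IsNormalizedPower (μ ν : Measure ℝ) (m : ℕ) : Prop :=
  ∀ z : ℂ, complexMGF id ν z = complexMGF id μ (z / (√m : ℝ)) ^ m

namespace IsNormalizedPower

variable {μ ν : Measure ℝ} {m : ℕ}

lemma mgf_eq (h : IsNormalizedPower μ ν m) (t : ℝ) :
    mgf id ν t = mgf id μ (t / √m) ^ m := by
  have := h t
  rw [← Complex.ofReal_div, complexMGF_ofReal, complexMGF_ofReal] at this
  exact_mod_cast this

lemma integrable_exp_mul (h : IsNormalizedPower μ ν m) (hμ : ∀ t, 1 ≤ mgf id μ t) (t : ℝ) :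
    Integrable (fun x ↦ Real.exp (t * x)) ν := by
  by_contra hcon
  have h1 : mgf id ν t = 0 := mgf_undef hcon
  rw [h.mgf_eq] at h1
  exact (pow_pos (zero_lt_one.trans_le (hμ _)) m).ne' h1

lemma norm_complexMGF_eq (h : IsNormalizedPower μ ν m) (hμ : ∀ t, 1 ≤ mgf id μ t) (t s : ℝ) :
    ‖complexMGF id ν (t + s * Complex.I)‖ =
      mgf id ν t * tiltedNorm μ (t / √m) (s / √m) ^ m := by
  rw [h, norm_pow, h.mgf_eq, ← mul_pow, tiltedNorm,
    mul_div_cancel₀ _ (zero_lt_one.trans_le (hμ _)).ne']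
  congr 3
  push_cast
  ring

lemma tiltedNorm_pow_eq (h : IsNormalizedPower μ ν m) (hμ : ∀ t, 1 ≤ mgf id μ t) (hm : 1 ≤ m)
    (t s : ℝ) : tiltedNorm μ t s ^ (2 * m) =
      ‖complexMGF id ν ((√m * t : ℝ) + (√m * s : ℝ) * Complex.I)‖ ^ 2 / mgf id ν (√m * t) ^ 2 := by
  have hm0 : √(m : ℝ) ≠ 0 := by positivity
  have hM : mgf id ν (√m * t) ≠ 0 := by
    rw [h.mgf_eq]; exact (pow_pos (zero_lt_one.trans_le (hμ _)) m).ne'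
  rw [h.norm_complexMGF_eq hμ, mul_div_cancel_left₀ _ hm0, mul_div_cancel_left₀ _ hm0, mul_pow,
    mul_div_cancel_left₀ _ (pow_ne_zero 2 hM), ← pow_mul, mul_comm]

/-- Bounds for the characteristic functions of all exponential tilts of `μ`, with constants of at
most Gaussian growth in the tilting parameter. They are inherited from the law `ν` of a normalized
sum that has finite `χ²`-divergence from the normal law. -/
theorem exists_tiltedNorm_bounds [IsProbabilityMeasure μ] [IsProbabilityMeasure ν]
    (h : IsNormalizedPower μ ν m) (hm : 1 ≤ m)
    (hμ : ∀ t, 1 ≤ mgf id μ t) (hsub : ∀ t, mgf id μ t ≤ Real.exp (t ^ 2 / 2)) (hν : ν ≪ volume)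
    (hχ : ∫⁻ x, (ν.rnDeriv volume x / gaussianPDF 0 1 x) ^ 2 * gaussianPDF 0 1 x < ⊤) :
    ∃ A b D : ℝ, 0 ≤ A ∧ 0 < b ∧ 0 ≤ D ∧ ∀ t,
      (∀ s, tiltedNorm μ t s ^ (2 * m) ≤ 1 - b * Real.exp (-(D * t ^ 2)) * min 1 (s ^ 2)) ∧
      ∫⁻ s, ENNReal.ofReal (tiltedNorm μ t s ^ (2 * m)) ≤
        ENNReal.ofReal (A * Real.exp (D * t ^ 2)) := by
  have hint := h.integrable_exp_mul hμ
  obtain ⟨κ, hκ, R, hdef⟩ := exists_complexMGF_defect_ge hν (NeZero.ne ν) hint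
  set B := ∫⁻ x, (ν.rnDeriv volume x / gaussianPDF 0 1 x) ^ 2 * gaussianPDF 0 1 x with hB
  have hm1 : (1 : ℝ) ≤ m := by exact_mod_cast hm
  have hsm1 : 1 ≤ √(m : ℝ) := Real.one_le_sqrt.2 hm1
  have hsm0 : 0 < √(m : ℝ) := by positivity
  have hsq : √(m : ℝ) ^ 2 = m := Real.sq_sqrt (by positivity)
  have hM1 (t : ℝ) : 1 ≤ mgf id ν (√m * t) := by
    rw [h.mgf_eq]; exact one_le_pow₀ (hμ _)
  have hM2 (t : ℝ) : mgf id ν (√m * t) ^ 2 ≤ Real.exp (m * t ^ 2) := by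
    rw [h.mgf_eq, mul_div_cancel_left₀ _ hsm0.ne', ← pow_mul]
    calc mgf id μ t ^ (m * 2) ≤ Real.exp (t ^ 2 / 2) ^ (m * 2) :=
          pow_le_pow_left₀ mgf_nonneg (hsub t) _
      _ = Real.exp (m * t ^ 2) := by
          rw [← Real.exp_nat_mul]; congr 1; push_cast; ring
  -- The exponent comes from `2 √m |t| R ≤ m t² + R²` and the bound `exp (m t²)` for the squared
  -- moment generating function of `ν` at `√m t`.
  refine ⟨2 * Real.pi * B.toReal, κ * Real.exp (-R ^ 2), 2 * m, by positivity, by positivity,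
    by positivity, fun t ↦ ⟨fun s ↦ ?_, ?_⟩⟩
  · rw [h.tiltedNorm_pow_eq hμ hm, div_le_iff₀ (pow_pos (zero_lt_one.trans_le (hM1 t)) 2)]
    have h1 := hdef (√m * t) (√m * s)
    refine (le_sub_comm.1 h1).trans ?_
    rw [sub_mul, one_mul]
    refine sub_le_sub_left ?_ _
    have h2 : min 1 (s ^ 2) ≤ min 1 ((√m * s) ^ 2) := by
      refine min_le_min le_rfl ?_
      rw [mul_pow, hsq]
      exact le_mul_of_one_le_left (sq_nonneg s) hm1
    have h3 : Real.exp (-R ^ 2) * Real.exp (-(2 * m * t ^ 2)) * Real.exp (m * t ^ 2) ≤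
        Real.exp (-(2 * |√m * t| * R)) := by
      rw [← Real.exp_add, ← Real.exp_add]
      refine Real.exp_le_exp.2 ?_
      have : |√m * t| ^ 2 = m * t ^ 2 := by rw [sq_abs, mul_pow, hsq]
      nlinarith [sq_nonneg (|√m * t| - R)]
    have h4 : 0 ≤ min 1 (s ^ 2) := le_min zero_le_one (sq_nonneg s)
    calc κ * Real.exp (-R ^ 2) * Real.exp (-(2 * m * t ^ 2)) * min 1 (s ^ 2) *
          mgf id ν (√m * t) ^ 2
        ≤ κ * Real.exp (-R ^ 2) * Real.exp (-(2 * m * t ^ 2)) * min 1 (s ^ 2) *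
          Real.exp (m * t ^ 2) := by gcongr; exact hM2 t
      _ = Real.exp (-R ^ 2) * Real.exp (-(2 * m * t ^ 2)) * Real.exp (m * t ^ 2) *
          (κ * min 1 (s ^ 2)) := by ring
      _ ≤ Real.exp (-(2 * |√m * t| * R)) * (κ * min 1 ((√m * s) ^ 2)) := by gcongr
  · have hmeas : Measurable fun s : ℝ ↦
        ‖complexMGF id ν ((√m * t : ℝ) + s * Complex.I)‖ₑ ^ 2 :=
      (measurable_complexMGF_line ν (√m * t)).enorm.pow_const 2
    calc ∫⁻ s, ENNReal.ofReal (tiltedNorm μ t s ^ (2 * m))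
        ≤ ∫⁻ s : ℝ, ‖complexMGF id ν ((√m * t : ℝ) + (√m * s : ℝ) * Complex.I)‖ₑ ^ 2 := by
          refine lintegral_mono fun s ↦ ?_
          simp only
          rw [h.tiltedNorm_pow_eq hμ hm, ← ofReal_norm, ← ENNReal.ofReal_pow (norm_nonneg _)]
          exact ENNReal.ofReal_le_ofReal (div_le_self (sq_nonneg _) (one_le_pow₀ (hM1 t)))
      _ = ENNReal.ofReal (√m)⁻¹ *
          ∫⁻ s : ℝ, ‖complexMGF id ν ((√m * t : ℝ) + s * Complex.I)‖ₑ ^ 2 :=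
          lintegral_comp_mul_left hmeas hsm0
      _ ≤ 1 * (ENNReal.ofReal (2 * Real.pi) *
            (ENNReal.ofReal (Real.exp (2 * (√m * t) ^ 2)) * B)) := by
          gcongr
          · exact ENNReal.ofReal_le_one.2 (inv_le_one_of_one_le₀ hsm1)
          · exact lintegral_complexMGF_sq_le hν (hint _)
      _ = ENNReal.ofReal (2 * Real.pi * B.toReal * Real.exp (2 * m * t ^ 2)) := by
          rw [one_mul, mul_assoc (2 * Real.pi), mul_comm B.toReal,
            ENNReal.ofReal_mul (p := 2 * Real.pi) (by positivity),
            ENNReal.ofReal_mul (Real.exp_pos _).le, ENNReal.ofReal_toReal hχ.ne, mul_pow, hsq,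
            mul_assoc 2]

end IsNormalizedPower

/-! ### Density bounds for normalized sums -/

lemma ae_le_of_withDensity_le {f g : ℝ → ℝ≥0∞} (hf : Measurable f)
    (h : (volume : Measure ℝ).withDensity f ≤ volume.withDensity g) : f ≤ᵐ[volume] g := by
  refine ae_le_of_forall_setLIntegral_le_of_sigmaFinite hf fun s hs _ ↦ ?_
  simpa [withDensity_apply _ hs] using h s

section

variable {μ : Measure ℝ} {ρ : ℕ → Measure ℝ}

lemma IsNormalizedPower.mgf_le {ν : Measure ℝ} {n : ℕ} (h : IsNormalizedPower μ ν n) (hn : 1 ≤ n)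
    (hsub : ∀ t, mgf id μ t ≤ Real.exp (t ^ 2 / 2)) (t : ℝ) :
    mgf id ν t ≤ Real.exp (t ^ 2 / 2) := by
  have hn0 : (0 : ℝ) < n := by exact_mod_cast hn
  rw [h.mgf_eq]
  calc mgf id μ (t / √n) ^ n ≤ Real.exp ((t / √n) ^ 2 / 2) ^ n :=
        pow_le_pow_left₀ mgf_nonneg (hsub _) _
    _ = Real.exp (t ^ 2 / 2) := by
        rw [← Real.exp_nat_mul, div_pow, Real.sq_sqrt hn0.le]
        congr 1
        field_simp

/-- All exponential tilts of the normalized sums have bounded densities, with bounds that are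
uniform in the number of summands up to a factor `exp (c h² / n)`. -/
theorem exists_expTilt_le [IsProbabilityMeasure μ] [∀ n, IsProbabilityMeasure (ρ n)]
    (hρ : ∀ n, IsNormalizedPower μ (ρ n) n) (hμ : ∀ t, 1 ≤ mgf id μ t)
    (hsub : ∀ t, mgf id μ t ≤ Real.exp (t ^ 2 / 2)) {N : ℕ} (hN : 1 ≤ N) {A b D : ℝ}
    (hA : 0 ≤ A) (hb : 0 < b) (hD : 0 ≤ D)
    (hbound : ∀ t,
      (∀ s, tiltedNorm μ t s ^ N ≤ 1 - b * Real.exp (-(D * t ^ 2)) * min 1 (s ^ 2)) ∧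
      ∫⁻ s, ENNReal.ofReal (tiltedNorm μ t s ^ N) ≤ ENNReal.ofReal (A * Real.exp (D * t ^ 2))) :
    ∃ C : ℝ, 0 < C ∧ ∀ n, 2 * N ≤ n → ∀ h : ℝ, expTilt (ρ n) h ≤
      ENNReal.ofReal (C * Real.exp (h ^ 2 / 2 + 2 * D * h ^ 2 / n)) • volume := by
  refine ⟨(2 + A) * √(4 * N / b), by positivity, fun n hn h ↦ ?_⟩
  have hn1 : 1 ≤ n := by omega
  have hn0 : (0 : ℝ) < n := by exact_mod_cast hn1
  have hsn0 : 0 < √(n : ℝ) := Real.sqrt_pos.2 hn0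
  have := isFiniteMeasure_expTilt ((hρ n).integrable_exp_mul hμ h)
  set t := h / √n with ht
  have ht2 : D * t ^ 2 = D * h ^ 2 / n := by rw [ht, div_pow, Real.sq_sqrt hn0.le]; ring
  have hpow := lintegral_pow_le hN hn (measurable_tiltedNorm μ t) (tiltedNorm_nonneg μ t)
    (tiltedNorm_le_one μ t) (by positivity : 0 < b * Real.exp (-(D * t ^ 2))) (by positivity)
    (hbound t).1 (hbound t).2
  have hconst : √n * ((2 + A * Real.exp (D * t ^ 2)) *
      √(4 * N / (b * Real.exp (-(D * t ^ 2)))) / √n) ≤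
      (2 + A) * √(4 * N / b) * Real.exp (2 * D * h ^ 2 / n) := by
    have h1 : √(4 * N / (b * Real.exp (-(D * t ^ 2)))) =
        √(4 * N / b) * Real.exp (D * t ^ 2 / 2) := by
      rw [← div_div, Real.exp_neg, div_inv_eq_mul, Real.sqrt_mul (by positivity), Real.exp_half]
    have h2 : 1 ≤ Real.exp (D * t ^ 2) := Real.one_le_exp (by positivity)
    have h3 : Real.exp (D * t ^ 2) * Real.exp (D * t ^ 2 / 2) ≤ Real.exp (2 * D * h ^ 2 / n) := by
      rw [← Real.exp_add]
      refine Real.exp_le_exp.2 ?_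
      have h5 : 2 * D * h ^ 2 / n = 2 * (D * t ^ 2) := by rw [ht2]; ring
      rw [h5]
      linarith [mul_nonneg hD (sq_nonneg t)]
    rw [h1, mul_div_cancel₀ _ hsn0.ne']
    calc (2 + A * Real.exp (D * t ^ 2)) * (√(4 * N / b) * Real.exp (D * t ^ 2 / 2))
        ≤ ((2 + A) * Real.exp (D * t ^ 2)) * (√(4 * N / b) * Real.exp (D * t ^ 2 / 2)) := by
          gcongr
          nlinarith
      _ = (2 + A) * √(4 * N / b) * (Real.exp (D * t ^ 2) * Real.exp (D * t ^ 2 / 2)) := by ring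
      _ ≤ _ := by gcongr
  have hmain := measure_le_add_smul_volume (expTilt (ρ n) h) 0
    (c := ENNReal.ofReal ((2 + A) * √(4 * N / b) * Real.exp (h ^ 2 / 2 + 2 * D * h ^ 2 / n)))
    ENNReal.ofReal_ne_top ?_
  · simpa using hmain
  calc ∫⁻ s, ‖charFun (expTilt (ρ n) h) s - charFun (0 : Measure ℝ) s‖ₑ
      = ∫⁻ s, ENNReal.ofReal (mgf id (ρ n) h) *
          ENNReal.ofReal (tiltedNorm μ t ((√n)⁻¹ * s) ^ n) := by
        refine lintegral_congr fun s ↦ ?_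
        rw [charFun_zero_measure, sub_zero, ← ofReal_norm, charFun_expTilt,
          (hρ n).norm_complexMGF_eq hμ, ENNReal.ofReal_mul mgf_nonneg, inv_mul_eq_div]
    _ = ENNReal.ofReal (mgf id (ρ n) h) * (ENNReal.ofReal √n *
          ∫⁻ s, ENNReal.ofReal (tiltedNorm μ t s ^ n)) := by
        rw [lintegral_const_mul' _ _ ENNReal.ofReal_ne_top,
          lintegral_comp_mul_left (f := fun s ↦ ENNReal.ofReal (tiltedNorm μ t s ^ n))
            ((measurable_tiltedNorm μ t).pow_const n).ennreal_ofReal (inv_pos.2 hsn0), inv_inv]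
    _ ≤ ENNReal.ofReal (Real.exp (h ^ 2 / 2)) * (ENNReal.ofReal √n * ENNReal.ofReal
          ((2 + A * Real.exp (D * t ^ 2)) * √(4 * N / (b * Real.exp (-(D * t ^ 2)))) / √n)) := by
        gcongr
        exact (hρ n).mgf_le hn1 hsub h
    _ ≤ 1 * ENNReal.ofReal
          ((2 + A) * √(4 * N / b) * Real.exp (h ^ 2 / 2 + 2 * D * h ^ 2 / n)) := by
        rw [one_mul, ← ENNReal.ofReal_mul hsn0.le, ← ENNReal.ofReal_mul (Real.exp_pos _).le]
        refine ENNReal.ofReal_le_ofReal ?_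
        rw [Real.exp_add]
        calc _ ≤ Real.exp (h ^ 2 / 2) *
              ((2 + A) * √(4 * N / b) * Real.exp (2 * D * h ^ 2 / n)) := by gcongr
          _ = _ := by ring
    _ ≤ _ := by
        gcongr
        rw [ENNReal.one_le_ofReal]
        linarith [Real.pi_gt_three]

lemma absolutelyContinuous_of_expTilt_le {ν : Measure ℝ} {c : ℝ≥0∞}
    (h : expTilt ν 0 ≤ c • volume) : ν ≪ volume := by
  have h0 : expTilt ν 0 = ν := by simp [expTilt]
  rw [h0] at h
  exact h.absolutelyContinuous.trans Measure.smul_absolutelyContinuous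

/-- Optimizing over the tilting parameter `h = x` at almost every point `x` turns bounds for the
densities of the tilts into a pointwise Gaussian bound. -/
theorem ae_rnDeriv_le_of_expTilt_le {ν : Measure ℝ} [IsFiniteMeasure ν] {C d : ℝ}
    (h : ∀ t : ℝ, expTilt ν t ≤ ENNReal.ofReal (C * Real.exp (t ^ 2 / 2 + d * t ^ 2)) • volume) :
    ∀ᵐ x, ν.rnDeriv volume x ≤ ENNReal.ofReal (C * Real.exp (-(x ^ 2 / 2) + d * x ^ 2)) := by
  have hν : ν ≪ volume := absolutelyContinuous_of_expTilt_le (h 0)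
  have hpm : Measurable (ν.rnDeriv volume) := Measure.measurable_rnDeriv _ _
  -- The exceptional null set depends on `t`, so `t` is first restricted to the rationals.
  have hq : ∀ᵐ x, ∀ q : ℚ, ν.rnDeriv volume x * ENNReal.ofReal (Real.exp (q * x)) ≤
      ENNReal.ofReal (C * Real.exp ((q : ℝ) ^ 2 / 2 + d * (q : ℝ) ^ 2)) := by
    rw [ae_all_iff]
    intro q
    refine ae_le_of_withDensity_le (by fun_prop) ?_
    have h1 := h q
    rw [expTilt] at h1
    conv_lhs at h1 => rw [← Measure.withDensity_rnDeriv_eq ν volume hν]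
    rw [withDensity_const]
    refine le_trans (le_of_eq ?_) h1
    exact withDensity_mul _ hpm (by fun_prop)
  filter_upwards [hq, Measure.rnDeriv_lt_top ν volume] with x hx hfin
  set p := (ν.rnDeriv volume x).toReal with hp
  have hpx : ν.rnDeriv volume x = ENNReal.ofReal p := (ENNReal.ofReal_toReal hfin.ne).symm
  have hall : ∀ t : ℝ, p * Real.exp (t * x) ≤ max 0 (C * Real.exp (t ^ 2 / 2 + d * t ^ 2)) := by
    intro t
    have hcl : IsClosed {t : ℝ | p * Real.exp (t * x) ≤
        max 0 (C * Real.exp (t ^ 2 / 2 + d * t ^ 2))} :=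
      isClosed_le (by fun_prop) (by fun_prop)
    refine Rat.denseRange_cast.induction_on (p := fun t : ℝ ↦ p * Real.exp (t * x) ≤
        max 0 (C * Real.exp (t ^ 2 / 2 + d * t ^ 2))) t hcl fun q ↦ ?_
    have h1 := hx q
    rw [hpx, ← ENNReal.ofReal_mul ENNReal.toReal_nonneg] at h1
    have h2 := ENNReal.toReal_mono ENNReal.ofReal_ne_top h1
    rwa [ENNReal.toReal_ofReal (mul_nonneg ENNReal.toReal_nonneg (Real.exp_pos _).le),
      ENNReal.toReal_ofReal', max_comm] at h2
  rw [hpx]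
  have h3 := hall x
  rcases le_total 0 C with hC | hC
  · rw [max_eq_right (by positivity), Real.exp_add] at h3
    refine ENNReal.ofReal_le_ofReal ?_
    rw [Real.exp_add, Real.exp_neg]
    have h4 : Real.exp (x * x) = Real.exp (x ^ 2 / 2) * Real.exp (x ^ 2 / 2) := by
      rw [← Real.exp_add]; congr 1; ring
    rw [h4] at h3
    have h5 := Real.exp_pos (x ^ 2 / 2)
    rw [← mul_assoc, ← div_eq_mul_inv, div_mul_eq_mul_div, le_div_iff₀ h5]
    refine le_of_mul_le_mul_right ?_ h5
    linarith
  · rw [max_eq_left (mul_nonpos_of_nonpos_of_nonneg hC (Real.exp_pos _).le)] at h3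
    have : p ≤ 0 := by
      by_contra hcon
      push Not at hcon
      exact absurd h3 (not_le.2 (by positivity))
    simp [ENNReal.ofReal_of_nonpos this]

end

/-! ### The local limit theorem -/

lemma tendsto_exp_neg_mul_sqrt {β : ℝ} (hβ : 0 < β) (A : ℝ) :
    Tendsto (fun n : ℕ ↦ Real.exp (-(β * n)) * (√n * A)) atTop (𝓝 0) := by
  have h := (tendsto_rpow_mul_exp_neg_mul_atTop_nhds_zero (1 / 2) β hβ).comp
    (tendsto_natCast_atTop_atTop (R := ℝ)) |>.mul_const A
  rw [zero_mul] at h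
  refine h.congr fun n ↦ ?_
  simp only [Function.comp, Real.sqrt_eq_rpow]
  ring_nf

/-- The characteristic functions of the normalized sums converge in `L¹`. On the scale `s ∼ √n` the
powers of `tiltedNorm` are not dominated by a fixed integrable function, but the undominated part
is exponentially small in `n`. -/
theorem tendsto_lintegral_charFun_sub {μ : Measure ℝ} {ρ : ℕ → Measure ℝ}
    [IsProbabilityMeasure μ] [∀ n, IsProbabilityMeasure (ρ n)]
    (hρ : ∀ n, IsNormalizedPower μ (ρ n) n) (hμ : ∀ t, 1 ≤ mgf id μ t)
    {N : ℕ} (hN : 1 ≤ N) {A b : ℝ} (hb : 0 < b)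
    (hbound : ∀ s, tiltedNorm μ 0 s ^ N ≤ 1 - b * min 1 (s ^ 2))
    (hint : ∫⁻ s, ENNReal.ofReal (tiltedNorm μ 0 s ^ N) ≤ ENNReal.ofReal A)
    (hlim : ∀ s, Tendsto (fun n ↦ charFun (ρ n) s) atTop (𝓝 (charFun (gaussianReal 0 1) s))) :
    Tendsto (fun n ↦ ∫⁻ s, ‖charFun (ρ n) s - charFun (gaussianReal 0 1) s‖ₑ) atTop (𝓝 0) := by
  have hN0 : (0 : ℝ) < N := by exact_mod_cast hN
  set β := b / (4 * N) with hβ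
  have hβ0 : 0 < β := by positivity
  set a : ℕ → ℝ → ℝ≥0∞ := fun n s ↦ ‖charFun (ρ n) s - charFun (gaussianReal 0 1) s‖ₑ with ha
  have ham (n : ℕ) : Measurable (a n) := by fun_prop
  set g : ℝ → ℝ≥0∞ := fun s ↦
    ENNReal.ofReal (Real.exp (-β * s ^ 2)) + ENNReal.ofReal (Real.exp (-(1 / 2) * s ^ 2)) with hg
  have hgm : Measurable g := by fun_prop
  set r : ℕ → ℝ → ℝ≥0∞ := fun n s ↦
    ENNReal.ofReal (Real.exp (-(β * n))) * ENNReal.ofReal (tiltedNorm μ 0 ((√n)⁻¹ * s) ^ N) with hr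
  have hTm : Measurable fun s ↦ ENNReal.ofReal (tiltedNorm μ 0 s ^ N) :=
    ((measurable_tiltedNorm μ 0).pow_const N).ennreal_ofReal
  have hrm (n : ℕ) : Measurable (r n) := (hTm.comp (measurable_const_mul _)).const_mul _
  -- Since `a n ≤ g + r n`, also `a n ≤ min (a n) g + r n`, and the minimum is dominated by `g`.
  have hmain : Tendsto (fun n ↦ ∫⁻ s, min (a n s) (g s)) atTop (𝓝 0) := by
    have h0 : ∫⁻ _ : ℝ, (0 : ℝ≥0∞) = 0 := by simp
    rw [← h0]
    refine tendsto_lintegral_of_dominated_convergence g (fun n ↦ (ham n).min hgm)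
      (fun n ↦ ae_of_all _ fun s ↦ min_le_right _ _) ?_ (ae_of_all _ fun s ↦ ?_)
    · rw [hg, lintegral_add_left (by fun_prop), lintegral_exp_neg_mul_sq hβ0,
        lintegral_exp_neg_mul_sq (by norm_num)]
      exact ENNReal.add_ne_top.2 ⟨ENNReal.ofReal_ne_top, ENNReal.ofReal_ne_top⟩
    · have h1 : Tendsto (fun n ↦ a n s) atTop (𝓝 0) := by
        have := ((hlim s).sub_const (charFun (gaussianReal 0 1) s)).enorm
        simpa using this
      exact tendsto_of_tendsto_of_tendsto_of_le_of_le tendsto_const_nhds h1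
        (fun _ ↦ zero_le) (fun n ↦ min_le_left _ _)
  have hrest : Tendsto (fun n : ℕ ↦ ENNReal.ofReal (Real.exp (-(β * n)) * (√n * A))) atTop
      (𝓝 0) := by
    have h := ENNReal.tendsto_ofReal (tendsto_exp_neg_mul_sqrt hβ0 A)
    rwa [ENNReal.ofReal_zero] at h
  have hsum := hmain.add hrest
  rw [add_zero] at hsum
  refine tendsto_of_tendsto_of_tendsto_of_le_of_le' tendsto_const_nhds hsum
    (Eventually.of_forall fun _ ↦ zero_le) ?_
  filter_upwards [eventually_ge_atTop (2 * N)] with n hn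
  obtain ⟨k, hk, hkn⟩ := exists_block_decomposition hN hn
  have hn0 : (0 : ℝ) < n := by exact_mod_cast (by omega : 0 < n)
  have hsn0 : 0 < √(n : ℝ) := Real.sqrt_pos.2 hn0
  have hmgf0 : mgf id (ρ n) 0 = 1 := mgf_zero
  have hpt (s : ℝ) : a n s ≤ g s + r n s := by
    have hT : ‖charFun (ρ n) s‖ = tiltedNorm μ 0 ((√n)⁻¹ * s) ^ n := by
      have h1 := (hρ n).norm_complexMGF_eq hμ 0 s
      rw [hmgf0, one_mul, zero_div, Complex.ofReal_zero, zero_add, complexMGF_id_mul_I] at h1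
      rw [h1, inv_mul_eq_div]
    have h2 : ‖charFun (gaussianReal 0 1) s‖ = Real.exp (-(1 / 2) * s ^ 2) := by
      rw [charFun_gaussianReal, Complex.norm_exp]
      congr 1
      simp only [Complex.ofReal_zero, mul_zero, zero_mul, zero_sub, NNReal.coe_one,
        Complex.ofReal_one, one_mul]
      norm_cast
      ring
    have h3 := pow_le_exp_add (tiltedNorm_nonneg μ 0 _) (tiltedNorm_le_one μ 0 _)
      (hbound ((√n)⁻¹ * s)) hk
    have h4 : Real.exp (-(b * (k + 1)) * ((√n)⁻¹ * s) ^ 2) ≤ Real.exp (-β * s ^ 2) := by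
      refine Real.exp_le_exp.2 ?_
      rw [mul_pow, inv_pow, Real.sq_sqrt hn0.le, neg_mul, neg_mul, neg_le_neg_iff, ← mul_assoc]
      refine mul_le_mul_of_nonneg_right ?_ (sq_nonneg s)
      rw [hβ, ← div_eq_mul_inv, div_le_div_iff₀ (by positivity) hn0, mul_assoc]
      refine mul_le_mul_of_nonneg_left ?_ hb.le
      nlinarith
    have h5 : Real.exp (-(b * k)) ≤ Real.exp (-(β * n)) := by
      refine Real.exp_le_exp.2 (neg_le_neg ?_)
      rw [hβ, div_mul_eq_mul_div, div_le_iff₀ (by positivity)]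
      nlinarith
    have h6 : 0 ≤ tiltedNorm μ 0 ((√n)⁻¹ * s) ^ N := pow_nonneg (tiltedNorm_nonneg ..) _
    simp only [ha, hg, hr]
    rw [← ENNReal.ofReal_mul (Real.exp_pos _).le, ← ENNReal.ofReal_add (Real.exp_pos _).le
      (Real.exp_pos _).le, ← ENNReal.ofReal_add (by positivity) (by positivity), ← ofReal_norm]
    refine ENNReal.ofReal_le_ofReal ((norm_sub_le _ _).trans ?_)
    rw [hT, h2]
    have h7 := mul_le_mul_of_nonneg_right h5 h6
    linarith
  calc ∫⁻ s, a n s ≤ ∫⁻ s, (min (a n s) (g s) + r n s) := by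
        refine lintegral_mono fun s ↦ ?_
        rcases le_total (a n s) (g s) with h | h
        · simp only [min_eq_left h]; exact le_self_add
        · simp only [min_eq_right h]; exact hpt s
    _ = (∫⁻ s, min (a n s) (g s)) + ∫⁻ s, r n s := lintegral_add_right _ (hrm n)
    _ ≤ (∫⁻ s, min (a n s) (g s)) + ENNReal.ofReal (Real.exp (-(β * n)) * (√n * A)) := by
        gcongr
        rw [hr, lintegral_const_mul' _ _ ENNReal.ofReal_ne_top,
          lintegral_comp_mul_left hTm (inv_pos.2 hsn0), inv_inv,
          ENNReal.ofReal_mul (Real.exp_pos _).le,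
          ENNReal.ofReal_mul hsn0.le]
        gcongr

lemma ae_withDensity_le_add {f g : ℝ → ℝ≥0∞} (hf : Measurable f) (hg : Measurable g)
    [IsFiniteMeasure ((volume : Measure ℝ).withDensity f)]
    [IsFiniteMeasure ((volume : Measure ℝ).withDensity g)] {c : ℝ≥0∞} (hc : c ≠ ⊤)
    (h : ∫⁻ s, ‖charFun (volume.withDensity f) s - charFun (volume.withDensity g) s‖ₑ ≤ c) :
    ∀ᵐ x, f x ≤ g x + c := by
  have hone : 1 ≤ ENNReal.ofReal (2 * Real.pi) := by
    rw [ENNReal.one_le_ofReal]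
    linarith [Real.pi_gt_three]
  have h1 := measure_le_add_smul_volume _ _ hc (h.trans (le_mul_of_one_le_left zero_le hone))
  rw [← withDensity_const, ← withDensity_add_left hg] at h1
  exact ae_le_of_withDensity_le hf h1

/-- `L¹`-convergence of characteristic functions gives uniform convergence of densities. -/
theorem ae_tendsto_rnDeriv {ρ : ℕ → Measure ℝ} [∀ n, IsProbabilityMeasure (ρ n)]
    (hac : ∀ᶠ n in atTop, ρ n ≪ volume)
    (h : Tendsto (fun n ↦ ∫⁻ s, ‖charFun (ρ n) s - charFun (gaussianReal 0 1) s‖ₑ) atTop (𝓝 0)) :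
    ∀ᵐ x, Tendsto (fun n ↦ (ρ n).rnDeriv volume x) atTop (𝓝 (gaussianPDF 0 1 x)) := by
  obtain ⟨c, hc⟩ : ∃ c : ℕ → ℝ≥0∞,
    c = fun n ↦ ∫⁻ s, ‖charFun (ρ n) s - charFun (gaussianReal 0 1) s‖ₑ := ⟨_, rfl⟩
  rw [← hc] at h
  have hcfin : ∀ᶠ n in atTop, c n < ⊤ := h.eventually_lt_const (by simp)
  have hgd : (volume : Measure ℝ).withDensity (gaussianPDF 0 1) = gaussianReal 0 1 :=
    (gaussianReal_of_var_ne_zero 0 one_ne_zero).symm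
  have : IsFiniteMeasure ((volume : Measure ℝ).withDensity (gaussianPDF 0 1)) := by
    rw [hgd]; infer_instance
  obtain ⟨n₀, hn₀⟩ := eventually_atTop.1 (hac.and hcfin)
  have hall : ∀ᵐ x, ∀ n, n₀ ≤ n → (ρ n).rnDeriv volume x ≤ gaussianPDF 0 1 x + c n ∧
      gaussianPDF 0 1 x ≤ (ρ n).rnDeriv volume x + c n := by
    rw [ae_all_iff]
    intro n
    by_cases hn : n₀ ≤ n
    · obtain ⟨hacn, hcn⟩ := hn₀ n hn
      have hpm : Measurable ((ρ n).rnDeriv volume) := Measure.measurable_rnDeriv _ _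
      have hdn : (volume : Measure ℝ).withDensity ((ρ n).rnDeriv volume) = ρ n :=
        Measure.withDensity_rnDeriv_eq (ρ n) volume hacn
      have : IsFiniteMeasure ((volume : Measure ℝ).withDensity ((ρ n).rnDeriv volume)) := by
        rw [hdn]; infer_instance
      have h1 := ae_withDensity_le_add hpm (measurable_gaussianPDF 0 1) hcn.ne
        (by rw [hdn, hgd, hc])
      have h2 := ae_withDensity_le_add (measurable_gaussianPDF 0 1) hpm hcn.ne
        (by simp_rw [hdn, hgd, hc, ← enorm_neg (charFun (gaussianReal 0 1) _ - _), neg_sub]; rfl)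
      filter_upwards [h1, h2] with x hx1 hx2 _
      exact ⟨hx1, hx2⟩
    · exact ae_of_all _ fun x hn' ↦ absurd hn' hn
  filter_upwards [hall] with x hx
  have hup : Tendsto (fun n ↦ gaussianPDF 0 1 x + c n) atTop (𝓝 (gaussianPDF 0 1 x)) := by
    simpa using h.const_add (gaussianPDF 0 1 x)
  have hlow : Tendsto (fun n ↦ gaussianPDF 0 1 x - c n) atTop (𝓝 (gaussianPDF 0 1 x)) := by
    simpa using ENNReal.Tendsto.sub tendsto_const_nhds h (Or.inl (gaussianPDF_ne_top (x := x)))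
  refine tendsto_of_tendsto_of_tendsto_of_le_of_le' hlow hup ?_ ?_
  · filter_upwards [eventually_ge_atTop n₀] with n hn
    exact tsub_le_iff_right.2 (hx n hn).2
  · filter_upwards [eventually_ge_atTop n₀] with n hn
    exact (hx n hn).1

/-! ### Convergence of divergences -/

lemma gaussianPDF_ne_zero (x : ℝ) : gaussianPDF 0 1 x ≠ 0 := (gaussianPDF_pos 0 one_ne_zero x).ne'

lemma div_gaussianPDF_le {p : ℝ≥0∞} {C ε x : ℝ} (hC : 0 ≤ C)
    (hp : p ≤ ENNReal.ofReal (C * Real.exp (-(x ^ 2 / 2) + ε * x ^ 2))) :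
    p / gaussianPDF 0 1 x ≤ ENNReal.ofReal (C * √(2 * Real.pi) * Real.exp (ε * x ^ 2)) := by
  refine ENNReal.div_le_of_le_mul (hp.trans ?_)
  rw [gaussianPDF, ← ENNReal.ofReal_mul (by positivity)]
  refine ENNReal.ofReal_le_ofReal (le_of_eq ?_)
  rw [gaussianPDFReal, Real.exp_add, NNReal.coe_one, mul_one, sub_zero, mul_one, neg_div]
  have : √(2 * Real.pi) ≠ 0 := by positivity
  field_simp

/-- Convergence of the `f`-divergence integrals `∫ Φ(pₙ/φ) φ` under pointwise convergence of the
densities and domination by Gaussians with exponents arbitrarily close to that of `φ`. -/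
theorem tendsto_lintegral_comp_div_gaussianPDF {p : ℕ → ℝ → ℝ≥0∞} (hpm : ∀ n, Measurable (p n))
    (hp : ∀ᵐ x, Tendsto (fun n ↦ p n x) atTop (𝓝 (gaussianPDF 0 1 x))) {C : ℝ} (hC : 0 ≤ C)
    (hdom : ∀ ε > 0, ∀ᶠ n in atTop, ∀ᵐ x,
      p n x ≤ ENNReal.ofReal (C * Real.exp (-(x ^ 2 / 2) + ε * x ^ 2)))
    {Φ : ℝ≥0∞ → ℝ≥0∞} (hΦm : Measurable Φ) (hΦ : ContinuousAt Φ 1) {a : ℝ≥0∞} (ha : a ≠ ⊤) {α : ℝ}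
    (hα : 0 < α) (hΦle : ∀ r, Φ r ≤ a + r ^ α) :
    Tendsto (fun n ↦ ∫⁻ x, Φ (p n x / gaussianPDF 0 1 x) * gaussianPDF 0 1 x) atTop (𝓝 (Φ 1)) := by
  have hone : ∫⁻ x, Φ 1 * gaussianPDF 0 1 x = Φ 1 := by
    rw [lintegral_const_mul _ (measurable_gaussianPDF 0 1),
      lintegral_gaussianPDF_eq_one 0 one_ne_zero, mul_one]
  rw [← hone]
  set B := ENNReal.ofReal (C * √(2 * Real.pi)) ^ α with hB
  refine tendsto_lintegral_filter_of_dominated_convergence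
    (fun x ↦ a * gaussianPDF 0 1 x + B * ENNReal.ofReal (Real.exp (-(1 / 4) * x ^ 2)))
    (Eventually.of_forall fun n ↦ by fun_prop) ?_ ?_ ?_
  -- With `ε = 1 / (4 α)`, the `α`-th power of the density ratio uses up half of the Gaussian decay.
  · filter_upwards [hdom (1 / (4 * α)) (by positivity)] with n hn
    filter_upwards [hn] with x hx
    calc Φ (p n x / gaussianPDF 0 1 x) * gaussianPDF 0 1 x
        ≤ (a + (p n x / gaussianPDF 0 1 x) ^ α) * gaussianPDF 0 1 x := by gcongr; exact hΦle _
      _ ≤ (a + (ENNReal.ofReal (C * √(2 * Real.pi) * Real.exp (1 / (4 * α) * x ^ 2))) ^ α) *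
          gaussianPDF 0 1 x := by gcongr; exact div_gaussianPDF_le hC hx
      _ ≤ a * gaussianPDF 0 1 x + B * ENNReal.ofReal (Real.exp (-(1 / 4) * x ^ 2)) := by
          rw [add_mul, ENNReal.ofReal_mul (by positivity), ENNReal.mul_rpow_of_nonneg _ _ hα.le,
            mul_assoc]
          gcongr
          rw [ENNReal.ofReal_rpow_of_pos (Real.exp_pos _), gaussianPDF,
            ← ENNReal.ofReal_mul (by positivity)]
          refine ENNReal.ofReal_le_ofReal ?_
          rw [← Real.exp_mul, gaussianPDFReal]
          have h1 : (√(2 * Real.pi * (1 : ℝ≥0)))⁻¹ ≤ 1 := by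
            refine inv_le_one_of_one_le₀ (Real.one_le_sqrt.2 ?_)
            push_cast
            nlinarith [Real.pi_gt_three]
          calc Real.exp (1 / (4 * α) * x ^ 2 * α) * ((√(2 * Real.pi * (1 : ℝ≥0)))⁻¹ *
                Real.exp (-(x - 0) ^ 2 / (2 * (1 : ℝ≥0))))
              ≤ Real.exp (1 / (4 * α) * x ^ 2 * α) * (1 *
                Real.exp (-(x - 0) ^ 2 / (2 * (1 : ℝ≥0)))) := by gcongr
            _ = Real.exp (-(1 / 4) * x ^ 2) := by
                rw [one_mul, ← Real.exp_add]
                congr 1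
                push_cast
                field_simp
                ring
  · rw [lintegral_add_left (by fun_prop), lintegral_const_mul _ (measurable_gaussianPDF 0 1),
      lintegral_gaussianPDF_eq_one 0 one_ne_zero, lintegral_const_mul _ (by fun_prop),
      lintegral_exp_neg_mul_sq (by norm_num)]
    refine ENNReal.add_ne_top.2 ⟨by simpa using ha, ENNReal.mul_ne_top ?_ ENNReal.ofReal_ne_top⟩
    exact ENNReal.rpow_ne_top_of_nonneg hα.le ENNReal.ofReal_ne_top
  · filter_upwards [hp] with x hx
    have h1 : Tendsto (fun n ↦ p n x / gaussianPDF 0 1 x) atTop (𝓝 1) := by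
      have := ENNReal.Tendsto.div_const hx (Or.inl (gaussianPDF_ne_zero x)) (b := gaussianPDF 0 1 x)
      rwa [ENNReal.div_self (gaussianPDF_ne_zero x) gaussianPDF_ne_top] at this
    exact ENNReal.Tendsto.mul_const (hΦ.tendsto.comp h1) (Or.inr gaussianPDF_ne_top)

/-- At `r = ⊤` the left side is `klFun 0 = 1`. -/
lemma ofReal_klFun_toReal_le (r : ℝ≥0∞) :
    ENNReal.ofReal (InformationTheory.klFun r.toReal) ≤ 1 + r ^ (2 : ℝ) := by
  rcases eq_or_ne r ⊤ with rfl | hr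
  · simp
  lift r to ℝ≥0 using hr
  have h0 : (0 : ℝ) ≤ r := r.2
  have h1 : InformationTheory.klFun r ≤ 1 + (r : ℝ) ^ 2 := by
    rw [InformationTheory.klFun_apply]
    rcases eq_or_lt_of_le h0 with h | h
    · rw [← h]; simp
    · nlinarith [Real.log_le_sub_one_of_pos h]
  calc ENNReal.ofReal (InformationTheory.klFun r) ≤ ENNReal.ofReal (1 + (r : ℝ) ^ 2) :=
        ENNReal.ofReal_le_ofReal h1
    _ = _ := by
        rw [ENNReal.ofReal_add zero_le_one (by positivity), ENNReal.ofReal_one,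
          ENNReal.ofReal_pow h0, ENNReal.ofReal_coe_nnreal]
        norm_cast

lemma klDiv_gaussianReal_eq {ν : Measure ℝ} [IsFiniteMeasure ν] (hν : ν ≪ volume) :
    InformationTheory.klDiv ν (gaussianReal 0 1) =
      ∫⁻ x, ENNReal.ofReal (InformationTheory.klFun
        (ν.rnDeriv volume x / gaussianPDF 0 1 x).toReal) * gaussianPDF 0 1 x := by
  have hac : ν ≪ gaussianReal 0 1 := hν.trans (gaussianReal_absolutelyContinuous' 0 one_ne_zero)
  rw [InformationTheory.klDiv_eq_lintegral_klFun_of_ac hac,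
    gaussianReal_of_var_ne_zero 0 one_ne_zero,
    lintegral_withDensity_eq_lintegral_mul _ (measurable_gaussianPDF 0 1)
      (by have := InformationTheory.measurable_klFun; fun_prop)]
  refine lintegral_congr_ae ?_
  filter_upwards [Measure.rnDeriv_withDensity_right ν volume
    (measurable_gaussianPDF 0 1).aemeasurable (ae_of_all _ gaussianPDF_ne_zero)
    (ae_of_all _ fun _ ↦ gaussianPDF_ne_top)] with x hx
  rw [Pi.mul_apply, hx, mul_comm, mul_comm (gaussianPDF 0 1 x)⁻¹, ← div_eq_mul_inv]

/-- Convergence of all Rényi divergences, for orders below and above `1` and for relative entropy,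
by dominated convergence. -/
theorem tendsto_renyiDiv {ρ : ℕ → Measure ℝ} [∀ n, IsProbabilityMeasure (ρ n)]
    (hac : ∀ᶠ n in atTop, ρ n ≪ volume)
    (hp : ∀ᵐ x, Tendsto (fun n ↦ (ρ n).rnDeriv volume x) atTop (𝓝 (gaussianPDF 0 1 x)))
    {C : ℝ} (hC : 0 ≤ C)
    (hdom : ∀ ε > 0, ∀ᶠ n in atTop, ∀ᵐ x,
      (ρ n).rnDeriv volume x ≤ ENNReal.ofReal (C * Real.exp (-(x ^ 2 / 2) + ε * x ^ 2)))
    {α : ℝ} (hα : 0 < α) : Tendsto (fun n ↦ renyiDiv α (ρ n)) atTop (𝓝 0) := by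
  have hpm (n : ℕ) : Measurable ((ρ n).rnDeriv volume) := Measure.measurable_rnDeriv _ _
  rcases eq_or_ne α 1 with rfl | hα1
  · have h := tendsto_lintegral_comp_div_gaussianPDF hpm hp hC hdom
      (Φ := fun r ↦ ENNReal.ofReal (InformationTheory.klFun r.toReal))
      (by have := InformationTheory.measurable_klFun; fun_prop)
      (ENNReal.continuous_ofReal.continuousAt.comp
        (InformationTheory.continuous_klFun.continuousAt.comp
          (ENNReal.continuousAt_toReal ENNReal.one_ne_top)))
      ENNReal.one_ne_top two_pos ofReal_klFun_toReal_le
    rw [ENNReal.toReal_one, InformationTheory.klFun_one, ENNReal.ofReal_zero] at h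
    have h' := (continuous_coe_ennreal_ereal.tendsto 0).comp h
    rw [EReal.coe_ennreal_zero] at h'
    refine h'.congr' ?_
    filter_upwards [hac] with n hn
    rw [Function.comp_apply, ← klDiv_gaussianReal_eq hn, renyiDiv, if_pos hn, renyiDivDensity,
      if_pos rfl, Measure.withDensity_rnDeriv_eq _ _ hn]
  · have h := tendsto_lintegral_comp_div_gaussianPDF hpm hp hC hdom (Φ := fun r ↦ r ^ α)
      (by fun_prop) ENNReal.continuous_rpow_const.continuousAt ENNReal.zero_ne_top hα (by simp)
    rw [ENNReal.one_rpow] at h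
    have h1 := (ENNReal.continuous_log.tendsto 1).comp h
    rw [ENNReal.log_one] at h1
    have h2 := EReal.Tendsto.const_mul h1 (a := (((α - 1)⁻¹ : ℝ) : EReal))
      (Or.inl (EReal.coe_ne_bot _)) (Or.inl (EReal.coe_ne_top _))
    rw [mul_zero] at h2
    refine h2.congr' ?_
    filter_upwards [hac] with n hn
    rw [renyiDiv, if_pos hn, renyiDivDensity, if_neg hα1]
    rfl

/-! ### Consequences of a finite Rényi divergence -/

lemma absolutelyContinuous_of_renyiDiv_lt_top {α : ℝ} {ν : Measure ℝ} (h : renyiDiv α ν < ⊤) :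
    ν ≪ volume := by
  by_contra hcon
  simp [renyiDiv, hcon] at h

lemma renyiDiv_eq {α : ℝ} (hα : α ≠ 1) {ν : Measure ℝ} (hν : ν ≪ volume) :
    renyiDiv α ν = (((α - 1)⁻¹ : ℝ) : EReal) * ENNReal.log
      (∫⁻ x, (ν.rnDeriv volume x / gaussianPDF 0 1 x) ^ α * gaussianPDF 0 1 x) := by
  rw [renyiDiv, if_pos hν, renyiDivDensity, if_neg hα]

lemma lintegral_sq_lt_top_of_renyiDiv_two {ν : Measure ℝ} (h : renyiDiv 2 ν < ⊤) :
    ∫⁻ x, (ν.rnDeriv volume x / gaussianPDF 0 1 x) ^ 2 * gaussianPDF 0 1 x < ⊤ := by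
  rw [renyiDiv_eq (by norm_num) (absolutelyContinuous_of_renyiDiv_lt_top h)] at h
  norm_num at h
  simpa [ENNReal.log_lt_top_iff] using h

/-- A bound on the Rényi divergence of order `α > 1` bounds the moment generating function, by
Hölder's inequality. -/
lemma lintegral_exp_mul_le_of_renyiDiv_le {α β : ℝ} (hαβ : α.HolderConjugate β) {ν : Measure ℝ}
    [IsFiniteMeasure ν] (h : renyiDiv α ν ≤ 1) (t : ℝ) :
    ∫⁻ x, ENNReal.ofReal (Real.exp (t * x)) ∂ν ≤
      ENNReal.ofReal (Real.exp (1 + β * t ^ 2 / 2)) := by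
  have hα1 := hαβ.lt
  have hα0 := hαβ.pos
  have hβ0 := hαβ.symm.pos
  have hν := absolutelyContinuous_of_renyiDiv_lt_top (lt_of_le_of_lt h (EReal.coe_lt_top 1))
  set p := ν.rnDeriv volume with hp
  have hpm : Measurable p := Measure.measurable_rnDeriv _ _
  rw [renyiDiv_eq hα1.ne' hν] at h
  have hI : ∫⁻ x, (p x / gaussianPDF 0 1 x) ^ α * gaussianPDF 0 1 x ≤
      ENNReal.ofReal (Real.exp (α - 1)) := by
    rw [← ENNReal.log_le_log_iff, ENNReal.log_ofReal_of_pos (Real.exp_pos _), Real.log_exp]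
    have h1 := mul_le_mul_of_nonneg_left h
      (show (0 : EReal) ≤ ((α - 1 : ℝ) : EReal) by exact_mod_cast (sub_pos.2 hα1).le)
    rwa [mul_one, ← mul_assoc, ← EReal.coe_mul, mul_inv_cancel₀ (sub_pos.2 hα1).ne',
      EReal.coe_one, one_mul] at h1
  set N : Measure ℝ := gaussianReal 0 1 with hN
  have hNd : N = (volume : Measure ℝ).withDensity (gaussianPDF 0 1) :=
    gaussianReal_of_var_ne_zero 0 one_ne_zero
  have hI' : ∫⁻ x, (p x / gaussianPDF 0 1 x) ^ α ∂N ≤ ENNReal.ofReal (Real.exp (α - 1)) := by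
    rw [hNd, lintegral_withDensity_eq_lintegral_mul _ (measurable_gaussianPDF 0 1) (by fun_prop)]
    simpa only [Pi.mul_apply, mul_comm] using hI
  have hG : ∫⁻ x, ENNReal.ofReal (Real.exp (t * x)) ^ β ∂N =
      ENNReal.ofReal (Real.exp (t ^ 2 * β ^ 2 / 2)) := by
    have h1 := integrable_exp_mul_gaussianReal (μ := 0) (v := 1) (t * β)
    have h2 := congrFun (mgf_id_gaussianReal (μ := 0) (v := 1)) (t * β)
    calc ∫⁻ x, ENNReal.ofReal (Real.exp (t * x)) ^ β ∂N
        = ∫⁻ x, ENNReal.ofReal (Real.exp (t * β * x)) ∂N := by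
          refine lintegral_congr fun x ↦ ?_
          rw [ENNReal.ofReal_rpow_of_pos (Real.exp_pos _), ← Real.exp_mul]
          congr 2; ring
      _ = ENNReal.ofReal (mgf id N (t * β)) :=
          (ofReal_integral_eq_lintegral_ofReal h1 (ae_of_all _ fun _ ↦ (Real.exp_pos _).le)).symm
      _ = _ := by
          rw [h2]
          congr 2
          push_cast
          ring
  calc ∫⁻ x, ENNReal.ofReal (Real.exp (t * x)) ∂ν
      = ∫⁻ x, ((fun x ↦ p x / gaussianPDF 0 1 x) *
          fun x ↦ ENNReal.ofReal (Real.exp (t * x))) x ∂N := by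
        conv_lhs => rw [← Measure.withDensity_rnDeriv_eq ν volume hν]
        rw [hNd, lintegral_withDensity_eq_lintegral_mul _ hpm (by fun_prop),
          lintegral_withDensity_eq_lintegral_mul _ (measurable_gaussianPDF 0 1) (by fun_prop)]
        refine lintegral_congr fun x ↦ ?_
        simp only [Pi.mul_apply]
        rw [← mul_assoc, ENNReal.mul_div_cancel (gaussianPDF_ne_zero x) gaussianPDF_ne_top]
    _ ≤ (∫⁻ x, (p x / gaussianPDF 0 1 x) ^ α ∂N) ^ (1 / α) *
          (∫⁻ x, ENNReal.ofReal (Real.exp (t * x)) ^ β ∂N) ^ (1 / β) :=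
        ENNReal.lintegral_mul_le_Lp_mul_Lq N hαβ (by fun_prop) (by fun_prop)
    _ ≤ ENNReal.ofReal (Real.exp (α - 1)) ^ (1 / α) *
          ENNReal.ofReal (Real.exp (t ^ 2 * β ^ 2 / 2)) ^ (1 / β) := by
        rw [hG]
        gcongr
    _ ≤ ENNReal.ofReal (Real.exp (1 + β * t ^ 2 / 2)) := by
        rw [ENNReal.ofReal_rpow_of_pos (Real.exp_pos _),
          ENNReal.ofReal_rpow_of_pos (Real.exp_pos _),
          ← ENNReal.ofReal_mul (by positivity), ← Real.exp_mul, ← Real.exp_mul, ← Real.exp_add]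
        refine ENNReal.ofReal_le_ofReal (Real.exp_le_exp.2 (add_le_add ?_ (le_of_eq ?_)))
        · rw [mul_one_div, div_le_one hα0]; linarith
        · field_simp

/-! ### Normalized sums of independent variables -/

section

variable {Ω : Type*} [MeasurableSpace Ω] {P : Measure Ω} {X : ℕ → Ω → ℝ}

lemma aemeasurable_normalizedSum (hX : ∀ i, AEMeasurable (X i) P) (n : ℕ) :
    AEMeasurable (normalizedSum X n) P := by
  unfold normalizedSum
  exact (Finset.aemeasurable_fun_sum _ fun i _ ↦ hX i).div_const _

lemma isNormalizedPower_map [IsProbabilityMeasure P] (hindep : iIndepFun X P)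
    (hident : ∀ i, IdentDistrib (X i) (X 0) P P) (n : ℕ) :
    IsNormalizedPower (P.map (X 0)) (P.map (normalizedSum X n)) n := by
  have hX (i : ℕ) : AEMeasurable (X i) P := (hident i).aemeasurable_fst
  intro z
  rw [complexMGF_id_map (hX 0), complexMGF_id_map (aemeasurable_normalizedSum hX n)]
  have hind : iIndepFun (fun i : Fin n ↦ X i) P := hindep.precomp Fin.val_injective
  have h := iIndepFun.integral_fun_prod_comp (ι := Fin n) (𝕜 := ℂ) (X := fun i : Fin n ↦ X i) hind
    (f := fun _ x ↦ Complex.exp (z / (√n : ℝ) * x)) (fun i ↦ hX i)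
    (fun i ↦ Measurable.aestronglyMeasurable (by fun_prop))
  have h1 (i : Fin n) : ∫ ω, Complex.exp (z / (√n : ℝ) * X i ω) ∂P =
      complexMGF (X 0) P (z / (√n : ℝ)) := by
    rw [← complexMGF_congr_identDistrib (hident i)]; rfl
  simp_rw [h1] at h
  rw [Finset.prod_const, Finset.card_univ, Fintype.card_fin] at h
  rw [← h, complexMGF]
  refine integral_congr_ae (ae_of_all _ fun ω ↦ ?_)
  simp only
  rw [← Complex.exp_sum, normalizedSum, ← Finset.mul_sum,
    Fin.sum_univ_eq_sum_range (fun i ↦ (X i ω : ℂ))]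
  congr 1
  push_cast
  ring

lemma lintegral_exp_mul_sum [IsProbabilityMeasure P] (hindep : iIndepFun X P)
    (hident : ∀ i, IdentDistrib (X i) (X 0) P P) (t : ℝ) (n : ℕ) :
    ∫⁻ ω, ENNReal.ofReal (Real.exp (t * ∑ i ∈ Finset.range n, X i ω)) ∂P =
      (∫⁻ ω, ENNReal.ofReal (Real.exp (t * X 0 ω)) ∂P) ^ n := by
  have hX (i : ℕ) : AEMeasurable (X i) P := (hident i).aemeasurable_fst
  have hexp : Measurable fun x : ℝ ↦ ENNReal.ofReal (Real.exp (t * x)) := by fun_prop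
  induction n with
  | zero => simp
  | succ n ih =>
    have hi : IndepFun (∑ i ∈ Finset.range n, X i) (X n) P :=
      hindep.indepFun_finsetSum_of_notMem₀ hX (by simp)
    have hi' := hi.comp hexp hexp
    have hS : AEMeasurable (∑ i ∈ Finset.range n, X i) P :=
      Finset.aemeasurable_sum _ fun i _ ↦ hX i
    have h := lintegral_mul_eq_lintegral_mul_lintegral_of_indepFun''
      (hexp.comp_aemeasurable hS) (hexp.comp_aemeasurable (hX n)) hi'
    simp only [Function.comp_apply, Finset.sum_apply] at h
    have hn := ((hident n).comp hexp).lintegral_eq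
    simp only [Function.comp_apply] at hn
    rw [ih, hn, ← pow_succ] at h
    rw [← h]
    refine lintegral_congr fun ω ↦ ?_
    rw [Finset.sum_range_succ, mul_add, Real.exp_add, ENNReal.ofReal_mul (Real.exp_pos _).le]

/-- Vanishing of the Rényi divergences of all orders forces strict subgaussianity: the moment
generating function of the normalized sums tensorizes, while the divergence stays bounded. -/
theorem lintegral_exp_le_of_tendsto_renyiDiv [IsProbabilityMeasure P] (hindep : iIndepFun X P)
    (hident : ∀ i, IdentDistrib (X i) (X 0) P P)
    (h : ∀ α : ℝ, 1 < α →
      Tendsto (fun n : ℕ ↦ renyiDiv α (P.map (normalizedSum X n))) atTop (𝓝 0)) (t : ℝ) :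
    ∫⁻ ω, ENNReal.ofReal (Real.exp (t * X 0 ω)) ∂P ≤ ENNReal.ofReal (Real.exp (t ^ 2 / 2)) := by
  have hX (i : ℕ) : AEMeasurable (X i) P := (hident i).aemeasurable_fst
  have hexp (u : ℝ) : Measurable fun x : ℝ ↦ ENNReal.ofReal (Real.exp (u * x)) := by fun_prop
  have key : ∀ β : ℝ, 1 < β → ∫⁻ ω, ENNReal.ofReal (Real.exp (t * X 0 ω)) ∂P ≤
      ENNReal.ofReal (Real.exp (β * t ^ 2 / 2)) := by
    intro β hβ
    have hconj := Real.HolderConjugate.conjExponent hβ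
    have hlim : Tendsto (fun n : ℕ ↦ ENNReal.ofReal (Real.exp (1 / (n : ℝ) + β * t ^ 2 / 2))) atTop
        (𝓝 (ENNReal.ofReal (Real.exp (β * t ^ 2 / 2)))) := by
      refine ENNReal.tendsto_ofReal ((Real.continuous_exp.tendsto _).comp ?_)
      simpa using (tendsto_one_div_atTop_nhds_zero_nat (𝕜 := ℝ)).add_const (β * t ^ 2 / 2)
    refine ge_of_tendsto hlim ?_
    filter_upwards [(h _ hconj.symm.lt).eventually_lt_const (show (0 : EReal) < 1 by norm_num),
      eventually_ge_atTop 1] with n hn hn1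
    have hn0 : (0 : ℝ) < n := by exact_mod_cast hn1
    have hsn : √(n : ℝ) ≠ 0 := (Real.sqrt_pos.2 hn0).ne'
    have : IsProbabilityMeasure (P.map (normalizedSum X n)) :=
      Measure.isProbabilityMeasure_map (aemeasurable_normalizedSum hX n)
    have h1 := lintegral_exp_mul_le_of_renyiDiv_le hconj.symm hn.le (√n * t)
    rw [lintegral_map' (hexp _).aemeasurable (aemeasurable_normalizedSum hX n)] at h1
    have h2 : ∀ ω, √n * t * normalizedSum X n ω = t * ∑ i ∈ Finset.range n, X i ω := by
      intro ω
      rw [normalizedSum]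
      field_simp
    simp_rw [h2, lintegral_exp_mul_sum hindep hident] at h1
    have h3 : ENNReal.ofReal (Real.exp (1 + β * (√n * t) ^ 2 / 2)) =
        ENNReal.ofReal (Real.exp (1 / (n : ℝ) + β * t ^ 2 / 2)) ^ n := by
      rw [← ENNReal.ofReal_pow (Real.exp_pos _).le, ← Real.exp_nat_mul, mul_pow,
        Real.sq_sqrt hn0.le]
      congr 2
      field_simp
    rw [h3] at h1
    exact (ENNReal.pow_le_pow_left_iff (by omega)).1 h1
  have hlim : Tendsto (fun β : ℝ ↦ ENNReal.ofReal (Real.exp (β * t ^ 2 / 2))) (𝓝[>] 1)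
      (𝓝 (ENNReal.ofReal (Real.exp (1 * t ^ 2 / 2)))) :=
    ((ENNReal.continuous_ofReal.comp (by fun_prop)).tendsto 1).mono_left nhdsWithin_le_nhds
  rw [one_mul] at hlim
  exact ge_of_tendsto hlim (eventually_nhdsWithin_of_forall key)

lemma one_le_mgf [IsProbabilityMeasure P] {Y : Ω → ℝ} (hY : Integrable Y P)
    (hmean : ∫ ω, Y ω ∂P = 0) {t : ℝ} (hint : Integrable (fun ω ↦ Real.exp (t * Y ω)) P) :
    1 ≤ mgf Y P t := by
  have h : ∫ ω, (t * Y ω + 1) ∂P ≤ ∫ ω, Real.exp (t * Y ω) ∂P :=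
    integral_mono ((hY.const_mul t).add (integrable_const 1)) hint fun ω ↦ Real.add_one_le_exp _
  rw [integral_add (hY.const_mul t) (integrable_const 1), integral_const_mul, hmean] at h
  simpa [mgf] using h

/-- Strict subgaussianity and a finite divergence of order `2` for some normalized sum give
convergence of the divergences of all orders. -/
theorem tendsto_renyiDiv_of_subgaussian [IsProbabilityMeasure P] (hindep : iIndepFun X P)
    (hident : ∀ i, IdentDistrib (X i) (X 0) P P) (hL2 : MemLp (X 0) 2 P)
    (hmean : ∫ ω, X 0 ω ∂P = 0) (hvar : Var[X 0; P] = 1)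
    (hfin : ∃ n : ℕ, 1 ≤ n ∧ renyiDiv 2 (P.map (normalizedSum X n)) < ⊤)
    (hsub : ∀ t : ℝ, Integrable (fun ω ↦ Real.exp (t * X 0 ω)) P ∧
        ∫ ω, Real.exp (t * X 0 ω) ∂P ≤ Real.exp (t ^ 2 / 2)) {α : ℝ} (hα : 0 < α) :
    Tendsto (fun n : ℕ ↦ renyiDiv α (P.map (normalizedSum X n))) atTop (𝓝 0) := by
  have hX (i : ℕ) : AEMeasurable (X i) P := (hident i).aemeasurable_fst
  set μ := P.map (X 0) with hμdef
  set ρ : ℕ → Measure ℝ := fun n ↦ P.map (normalizedSum X n) with hρdef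
  have : IsProbabilityMeasure μ := Measure.isProbabilityMeasure_map (hX 0)
  have (n : ℕ) : IsProbabilityMeasure (ρ n) :=
    Measure.isProbabilityMeasure_map (aemeasurable_normalizedSum hX n)
  have hρ (n : ℕ) : IsNormalizedPower μ (ρ n) n := isNormalizedPower_map hindep hident n
  have hmgf : mgf id μ = mgf (X 0) P := mgf_id_map (hX 0)
  have hμ (t : ℝ) : 1 ≤ mgf id μ t := by
    rw [hmgf]; exact one_le_mgf (hL2.integrable (by norm_num)) hmean (hsub t).1
  have hμsub (t : ℝ) : mgf id μ t ≤ Real.exp (t ^ 2 / 2) := by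
    rw [hmgf]; exact (hsub t).2
  obtain ⟨m, hm, hfinm⟩ := hfin
  obtain ⟨A, b, D, hA, hb, hD, hbound⟩ := (hρ m).exists_tiltedNorm_bounds hm hμ hμsub
    (absolutelyContinuous_of_renyiDiv_lt_top hfinm) (lintegral_sq_lt_top_of_renyiDiv_two hfinm)
  have hN : 1 ≤ 2 * m := by omega
  obtain ⟨C, hC, hdens⟩ := exists_expTilt_le hρ hμ hμsub hN hA hb hD hbound
  have hdens' : ∀ n, 2 * (2 * m) ≤ n → ∀ t : ℝ, expTilt (ρ n) t ≤
      ENNReal.ofReal (C * Real.exp (t ^ 2 / 2 + 2 * D / n * t ^ 2)) • volume := by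
    intro n hn t
    have := hdens n hn t
    rwa [mul_div_right_comm] at this
  have hac : ∀ᶠ n in atTop, ρ n ≪ volume := by
    filter_upwards [eventually_ge_atTop (2 * (2 * m))] with n hn
    exact absolutelyContinuous_of_expTilt_le (hdens n hn 0)
  have h1 : P[X 0 ^ 2] = 1 := by
    have := variance_eq_sub hL2
    rw [hvar, hmean] at this
    simpa using this.symm
  have hchar (s : ℝ) : Tendsto (fun n ↦ charFun (ρ n) s) atTop
      (𝓝 (charFun (gaussianReal 0 1) s)) := by
    have h2 := tendsto_charFun_inv_sqrt_mul_pow (hX 0) hmean h1 s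
    have h3 : charFun (gaussianReal 0 1) s = Complex.exp (-s ^ 2 / 2) := by
      rw [charFun_gaussianReal]
      congr 1
      push_cast
      ring
    rw [h3]
    refine h2.congr fun n ↦ ?_
    rw [← charFun_inv_sqrt_mul_sum hindep hident, hρdef]
    congr 3
    ext ω
    rw [normalizedSum, inv_mul_eq_div]
  have hb0 := hbound 0
  simp only [ne_eq, OfNat.ofNat_ne_zero, not_false_eq_true, zero_pow, mul_zero, neg_zero,
    Real.exp_zero, mul_one] at hb0
  refine tendsto_renyiDiv hac (ae_tendsto_rnDeriv hac
    (tendsto_lintegral_charFun_sub hρ hμ hN hb hb0.1 hb0.2 hchar)) hC.le (fun ε hε ↦ ?_) hα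
  have hDn : Tendsto (fun n : ℕ ↦ 2 * D / n) atTop (𝓝 0) := tendsto_const_div_atTop_nhds_zero_nat _
  filter_upwards [eventually_ge_atTop (2 * (2 * m)), hDn.eventually_lt_const hε] with n hn hnε
  filter_upwards [ae_rnDeriv_le_of_expTilt_le (hdens' n hn)] with x hx
  refine hx.trans (ENNReal.ofReal_le_ofReal ?_)
  gcongr

end

end SubgaussianCLT

theorem theorem1p1 {Ω : Type*} [MeasurableSpace Ω] (P : Measure Ω) [IsProbabilityMeasure P]
    (X : ℕ → Ω → ℝ)
    (hindep : iIndepFun X P)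
    (hident : ∀ i, IdentDistrib (X i) (X 0) P P)
    (hL2 : MemLp (X 0) 2 P)
    (hmean : ∫ ω, X 0 ω ∂P = 0)
    (hvar : Var[X 0; P] = 1)
    (hfin : ∀ α : ℝ, 1 < α → ∃ n : ℕ, 1 ≤ n ∧ renyiDiv α (P.map (normalizedSum X n)) < ⊤) :
    ((∀ α : ℝ, 1 < α →
        Tendsto (fun n : ℕ => renyiDiv α (P.map (normalizedSum X n))) atTop (𝓝 0)) ↔
      ∀ t : ℝ, Integrable (fun ω => Real.exp (t * X 0 ω)) P ∧
        ∫ ω, Real.exp (t * X 0 ω) ∂P ≤ Real.exp (t ^ 2 / 2)) ∧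
    ((∀ α : ℝ, 0 < α →
        Tendsto (fun n : ℕ => renyiDiv α (P.map (normalizedSum X n))) atTop (𝓝 0)) ↔
      ∀ t : ℝ, Integrable (fun ω => Real.exp (t * X 0 ω)) P ∧
        ∫ ω, Real.exp (t * X 0 ω) ∂P ≤ Real.exp (t ^ 2 / 2)) := by
  have nec : (∀ α : ℝ, 1 < α →
        Tendsto (fun n : ℕ => renyiDiv α (P.map (normalizedSum X n))) atTop (𝓝 0)) →
      ∀ t : ℝ, Integrable (fun ω => Real.exp (t * X 0 ω)) P ∧
        ∫ ω, Real.exp (t * X 0 ω) ∂P ≤ Real.exp (t ^ 2 / 2) := by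
    intro h t
    have hle := SubgaussianCLT.lintegral_exp_le_of_tendsto_renyiDiv hindep hident h t
    have hm : AEStronglyMeasurable (fun ω => Real.exp (t * X 0 ω)) P :=
      ((hident 0).aemeasurable_fst.const_mul t).exp.aestronglyMeasurable
    have h0 : 0 ≤ᵐ[P] fun ω => Real.exp (t * X 0 ω) := ae_of_all _ fun _ ↦ (Real.exp_pos _).le
    refine ⟨⟨hm, ?_⟩, ?_⟩
    · rw [hasFiniteIntegral_iff_ofReal h0]
      exact hle.trans_lt ENNReal.ofReal_lt_top
    · rw [integral_eq_lintegral_of_nonneg_ae h0 hm]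
      exact ENNReal.toReal_le_of_le_ofReal (Real.exp_pos _).le hle
  have suff (hsub : ∀ t : ℝ, Integrable (fun ω => Real.exp (t * X 0 ω)) P ∧
        ∫ ω, Real.exp (t * X 0 ω) ∂P ≤ Real.exp (t ^ 2 / 2)) (α : ℝ) (hα : 0 < α) :
      Tendsto (fun n : ℕ => renyiDiv α (P.map (normalizedSum X n))) atTop (𝓝 0) :=
    SubgaussianCLT.tendsto_renyiDiv_of_subgaussian hindep hident hL2 hmean hvar
      (hfin 2 one_lt_two) hsub hα
  exact ⟨⟨nec, fun hsub α hα ↦ suff hsub α (by linarith)⟩,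
    ⟨fun h ↦ nec fun α hα ↦ h α (by linarith), suff⟩⟩
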